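/- All Banach spaces are real. Let $1\le p\le\infty$ and write $\ell^p_n$ for $\mathbb R^n$ with the $\ell^p$-norm. A \emph{$p$-multinormed space} is a Banach space $X$ together with norms $\|\cdot\|_n$ on the algebraic tensor products $\ell^p_n\otimes X$ ($n\in\mathbb N$) such that (1) $\|a\otimes x\|_n=\|a\|\,\|x\|$ for $a\in\ell^p_n$, $x\in X$; (2) $|\langle a^*\otimes x^*,t\rangle|\le\|t\|_n$ for $t\in\ell^p_n\otimes X$ and functionals $a^*\in(\ell^p_n)^*$, $x^*\in X^*$ of norm at most $1$; (3) $\|(T\otimes I_X)t\|_m\le\|T\|\,\|t\|_n$ for every $T\in B(\ell^p_n,\ell^p_m)$ and $t\in\ell^p_n\otimes X$. For a linear map $u:X\to Y$ between $p$-multinormed spaces put $\|u\|_p=\sup_n\|I_{\ell^p_n}\otimes u:\ell^p_n\otimes X\to\ell^p_n\otimes Y\|\in[0,\infty]$; $u$ is \emph{$p$-multibounded} if $\|u\|_p<\infty$. A $p$-multinormed space $Z$ is \emph{$1$-injective} if, whenever $Y$ is a $p$-multinormed space and $X\subset Y$ is a closed subspace with the inherited norms, every $p$-multibounded $u:X\to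 Z$ has a linear extension $\tilde u:Y\to Z$ with $\|\tilde u\|_p\le\|u\|_p$. For a Banach space $E$, $\max_p(E)$ is the $p$-multinormed space in which $\ell^p_n\otimes E$ carries the projective tensor norm. For $p$-multinormed spaces $(X_i)_{i\in I}$, the \emph{$\ell^\infty$-sum} $(\sum_i X_i)_\infty$ is the Banach space $\ell^\infty$-sum of the $X_i$ with $\|t\|_n=\sup_i\|t_i\|_{\ell^p_n\otimes X_i}$, where $t_i\in\ell^p_n\otimes X_i$ is the $i$-th coordinate of $t$. \textbf{Theorem.} Let $1\le p\le\infty$, $1/p+1/p'=1$, and let $(\Omega_i,\mu_i)_{i\in I}$ be any family of measure spaces; if $p=1$ (so that $p'=\infty$), assume that each $\mu_i$ is $\sigma$-finite. Then the $\ell^\infty$-sum $\big(\sum_{i\in I}\max_p(L^{p'}(\mu_i))\big)_\infty$ is a $1$-injective $p$-multinormed space. Moreover, each $\max_p(L^{p'}(\mu_i))$ and, for every $n\in\mathbb N$, $\max_p(\ell^{p'}_n)$ is a $1$-injective $p$-multinormed space. -/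

import Mathlib

open scoped TensorProduct ENNReal
open MeasureTheory

noncomputable section

/-- The space `ℓ^p_n` over the real field. -/
abbrev Ellp (p : ℝ≥0∞) (n : ℕ) : Type := PiLp p (fun _ : Fin n => ℝ)

/-- A `p`-multinorm structure on a real Banach space `X`: a tensorial sequence of cross-norms
on the algebraic tensor products `ℓ^p_n ⊗ X`, `n ∈ ℕ`. A Banach space together with such a structure
is a `p`-multinormed space. -/
structure PMultinorm (p : ℝ≥0∞) [Fact (1 ≤ p)] (X : Type*) [NormedAddCommGroup X]
    [NormedSpace ℝ X] [CompleteSpace X] where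
  /-- The norm on `ℓ^p_n ⊗ X`. -/
  nrm : ∀ n : ℕ, Seminorm ℝ (Ellp p n ⊗[ℝ] X)
  eq_zero : ∀ (n : ℕ) (t : Ellp p n ⊗[ℝ] X), nrm n t = 0 → t = 0
  /-- `‖a ⊗ x‖ = ‖a‖ ‖x‖`. -/
  cross : ∀ (n : ℕ) (a : Ellp p n) (x : X), nrm n (a ⊗ₜ[ℝ] x) = ‖a‖ * ‖x‖
  /-- `|⟨a^* ⊗ x^*, t⟩| ≤ ‖t‖` for functionals `a^*`, `x^*` of norm at most one. -/
  dual_le : ∀ (n : ℕ) (f : StrongDual ℝ (Ellp p n)) (g : StrongDual ℝ X), ‖f‖ ≤ 1 → ‖g‖ ≤ 1 →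
    ∀ t : Ellp p n ⊗[ℝ] X,
      |TensorProduct.dualDistrib ℝ (Ellp p n) X (f.toLinearMap ⊗ₜ[ℝ] g.toLinearMap) t| ≤ nrm n t
  /-- `‖(T ⊗ I) t‖ ≤ ‖T‖ ‖t‖` for every operator `T : ℓ^p_n → ℓ^p_m`. -/
  tensorial : ∀ (n m : ℕ) (T : Ellp p n →L[ℝ] Ellp p m) (t : Ellp p n ⊗[ℝ] X),
    nrm m (LinearMap.rTensor X T.toLinearMap t) ≤ ‖T‖ * nrm n t

namespace PMultinorm

section Basic

variable {p : ℝ≥0∞} [Fact (1 ≤ p)]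
  {X : Type*} [NormedAddCommGroup X] [NormedSpace ℝ X] [CompleteSpace X]
  {Y : Type*} [NormedAddCommGroup Y] [NormedSpace ℝ Y] [CompleteSpace Y]

/-- The `p`-norm `‖u‖_p = sup_n ‖I ⊗ u : ℓ^p_n ⊗ X → ℓ^p_n ⊗ Y‖` of a linear map, with
values in `[0, ∞]`. -/
def pNorm (α : PMultinorm p X) (β : PMultinorm p Y) (u : X →ₗ[ℝ] Y) : ℝ≥0∞ :=
  ⨆ (n : ℕ) (t : Ellp p n ⊗[ℝ] X) (_ : α.nrm n t ≤ 1),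
    ENNReal.ofReal (β.nrm n (LinearMap.lTensor (Ellp p n) u t))

/-- `u` is `p`-multibounded if its `p`-norm is finite. -/
def IsMultibounded (α : PMultinorm p X) (β : PMultinorm p Y) (u : X →ₗ[ℝ] Y) : Prop :=
  pNorm α β u < ∞

/-- `j` identifies the `p`-multinormed space `X` with a subspace of the `p`-multinormed space `Y`:
every `I ⊗ j : ℓ^p_n ⊗ X → ℓ^p_n ⊗ Y` is isometric. -/
def IsMultiIsometry (α : PMultinorm p X) (β : PMultinorm p Y) (j : X →ₗ[ℝ] Y) : Prop :=
  ∀ (n : ℕ) (t : Ellp p n ⊗[ℝ] X), β.nrm n (LinearMap.lTensor (Ellp p n) j t) = α.nrm n t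

end Basic

universe v w z

/-- A `p`-multinormed space `Z` is `c`-injective if every `p`-multibounded map from a
subspace `X` of a `p`-multinormed space `Y` into `Z` extends to `Y` with `p`-norm at most `c` times
the original one. -/
def IsInjective {p : ℝ≥0∞} [Fact (1 ≤ p)] {Z : Type z} [NormedAddCommGroup Z] [NormedSpace ℝ Z]
    [CompleteSpace Z] (γ : PMultinorm p Z) (c : NNReal) : Prop :=
  ∀ (X : Type v) [NormedAddCommGroup X] [NormedSpace ℝ X] [CompleteSpace X]
    (Y : Type w) [NormedAddCommGroup Y] [NormedSpace ℝ Y] [CompleteSpace Y]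
    (α : PMultinorm p X) (β : PMultinorm p Y) (j : X →ₗ[ℝ] Y), IsMultiIsometry α β j →
    ∀ u : X →ₗ[ℝ] Z, IsMultibounded α γ u →
      ∃ v : Y →ₗ[ℝ] Z, v ∘ₗ j = u ∧ pNorm β γ v ≤ c * pNorm α γ u

end PMultinorm

/-! ### The projective norm and the maximal structure -/

section Projective

variable {E F G : Type*} [NormedAddCommGroup E] [NormedSpace ℝ E]
  [NormedAddCommGroup F] [NormedSpace ℝ F] [NormedAddCommGroup G] [NormedSpace ℝ G]

/-- The sums `∑ ‖a_i‖ ‖x_i‖` over all representations `t = ∑ a_i ⊗ x_i`. -/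
def projCosts (t : E ⊗[ℝ] F) : Set ℝ :=
  {r | ∃ (k : ℕ) (a : Fin k → E) (x : Fin k → F),
    t = ∑ i, a i ⊗ₜ[ℝ] x i ∧ r = ∑ i, ‖a i‖ * ‖x i‖}

/-- The projective tensor norm on the algebraic tensor product `E ⊗ F`. -/
def projNorm (t : E ⊗[ℝ] F) : ℝ := sInf (projCosts t)

theorem projCosts_nonneg {t : E ⊗[ℝ] F} {r : ℝ} (h : r ∈ projCosts t) : 0 ≤ r := by
  obtain ⟨k, a, x, -, rfl⟩ := h
  positivity

theorem projCosts_bddBelow (t : E ⊗[ℝ] F) : BddBelow (projCosts t) :=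
  ⟨0, fun _ h => projCosts_nonneg h⟩

theorem projCosts_tmul (a : E) (x : F) : ‖a‖ * ‖x‖ ∈ projCosts (a ⊗ₜ[ℝ] x) :=
  ⟨1, fun _ => a, fun _ => x, by simp, by simp⟩

theorem projCosts_zero : (0 : ℝ) ∈ projCosts (0 : E ⊗[ℝ] F) :=
  ⟨0, fun _ => 0, fun _ => 0, by simp, by simp⟩

theorem projCosts_add {s t : E ⊗[ℝ] F} {r q : ℝ} (hr : r ∈ projCosts s) (hq : q ∈ projCosts t) :
    r + q ∈ projCosts (s + t) := by
  obtain ⟨k, a, x, rfl, rfl⟩ := hr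
  obtain ⟨l, b, y, rfl, rfl⟩ := hq
  refine ⟨k + l, Fin.append a b, Fin.append x y, ?_, ?_⟩ <;> simp [Fin.sum_univ_add]

theorem projCosts_map {s : E ⊗[ℝ] F} {r : ℝ} (T : E →L[ℝ] G) (hr : r ∈ projCosts s) :
    ∃ q ∈ projCosts (LinearMap.rTensor F T.toLinearMap s), q ≤ ‖T‖ * r := by
  obtain ⟨k, a, x, rfl, rfl⟩ := hr
  refine ⟨_, ⟨k, fun i => T (a i), x, by simp, rfl⟩, ?_⟩
  rw [Finset.mul_sum]
  refine Finset.sum_le_sum fun i _ => ?_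
  rw [← mul_assoc]
  exact mul_le_mul_of_nonneg_right (T.le_opNorm _) (norm_nonneg _)

theorem projCosts_nonempty (t : E ⊗[ℝ] F) : (projCosts t).Nonempty := by
  induction t with
  | zero => exact ⟨0, projCosts_zero⟩
  | tmul a x => exact ⟨_, projCosts_tmul a x⟩
  | add s t hs ht =>
    obtain ⟨r, hr⟩ := hs
    obtain ⟨q, hq⟩ := ht
    exact ⟨_, projCosts_add hr hq⟩

theorem projNorm_le {t : E ⊗[ℝ] F} {r : ℝ} (h : r ∈ projCosts t) : projNorm t ≤ r :=
  csInf_le (projCosts_bddBelow t) h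

theorem projNorm_nonneg (t : E ⊗[ℝ] F) : 0 ≤ projNorm t :=
  Real.sInf_nonneg fun _ h => projCosts_nonneg h

theorem projNorm_add_le (s t : E ⊗[ℝ] F) : projNorm (s + t) ≤ projNorm s + projNorm t := by
  refine le_of_forall_pos_le_add fun ε hε => ?_
  obtain ⟨r, hr, hr'⟩ := exists_lt_of_csInf_lt (projCosts_nonempty s)
    (show projNorm s < projNorm s + ε / 2 by linarith)
  obtain ⟨q, hq, hq'⟩ := exists_lt_of_csInf_lt (projCosts_nonempty t)
    (show projNorm t < projNorm t + ε / 2 by linarith)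
  have := projNorm_le (projCosts_add hr hq)
  linarith

theorem projNorm_map_le (T : E →L[ℝ] G) (t : E ⊗[ℝ] F) :
    projNorm (LinearMap.rTensor F T.toLinearMap t) ≤ ‖T‖ * projNorm t := by
  refine le_of_forall_pos_le_add fun ε hε => ?_
  have h1 : (0 : ℝ) < ‖T‖ + 1 := by positivity
  obtain ⟨r, hr, hr'⟩ := exists_lt_of_csInf_lt (projCosts_nonempty t)
    (show projNorm t < projNorm t + ε / (‖T‖ + 1) by linarith [div_pos hε h1])
  obtain ⟨q, hq, hq'⟩ := projCosts_map T hr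
  have h2 : ‖T‖ * r ≤ ‖T‖ * (projNorm t + ε / (‖T‖ + 1)) :=
    mul_le_mul_of_nonneg_left hr'.le (norm_nonneg _)
  have h3 : ‖T‖ * (ε / (‖T‖ + 1)) ≤ ε := by
    rw [mul_div_assoc', div_le_iff₀ h1]
    nlinarith [norm_nonneg T]
  have := projNorm_le hq
  linarith

theorem dual_le_projNorm (f : StrongDual ℝ E) (g : StrongDual ℝ F) (hf : ‖f‖ ≤ 1) (hg : ‖g‖ ≤ 1)
    (t : E ⊗[ℝ] F) :
    |TensorProduct.dualDistrib ℝ E F (f.toLinearMap ⊗ₜ[ℝ] g.toLinearMap) t| ≤ projNorm t := by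
  refine le_csInf (projCosts_nonempty t) ?_
  rintro r ⟨k, a, x, rfl, rfl⟩
  rw [map_sum]
  refine (Finset.abs_sum_le_sum_abs _ _).trans (Finset.sum_le_sum fun i _ => ?_)
  have h1 : ‖f (a i)‖ ≤ ‖a i‖ := by simpa using f.le_of_opNorm_le hf (a i)
  have h2 : ‖g (x i)‖ ≤ ‖x i‖ := by simpa using g.le_of_opNorm_le hg (x i)
  simpa [TensorProduct.dualDistrib_apply, abs_mul] using
    mul_le_mul h1 h2 (norm_nonneg _) (norm_nonneg _)

theorem projNorm_tmul (a : E) (x : F) : projNorm (a ⊗ₜ[ℝ] x) = ‖a‖ * ‖x‖ := by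
  refine le_antisymm (projNorm_le (projCosts_tmul a x)) ?_
  obtain ⟨f, hf, hfa⟩ := exists_dual_vector'' ℝ a
  obtain ⟨g, hg, hgx⟩ := exists_dual_vector'' ℝ x
  have := dual_le_projNorm f g hf hg (a ⊗ₜ[ℝ] x)
  simpa [TensorProduct.dualDistrib_apply, hfa, hgx] using this

/-- The projective norm as a seminorm. -/
def projSeminorm (E F : Type*) [NormedAddCommGroup E] [NormedSpace ℝ E]
    [NormedAddCommGroup F] [NormedSpace ℝ F] : Seminorm ℝ (E ⊗[ℝ] F) :=
  Seminorm.ofSMulLE projNorm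
    (le_antisymm (projNorm_le projCosts_zero) (projNorm_nonneg _)) projNorm_add_le
    (fun c t => by
      have h := projNorm_map_le (c • ContinuousLinearMap.id ℝ E) t
      have h1 : LinearMap.rTensor F (c • ContinuousLinearMap.id ℝ E).toLinearMap t = c • t := by
        have : (c • ContinuousLinearMap.id ℝ E).toLinearMap = c • LinearMap.id := rfl
        rw [this, LinearMap.rTensor_smul, LinearMap.rTensor_id]; rfl
      rw [h1] at h
      refine h.trans (mul_le_mul_of_nonneg_right ?_ (projNorm_nonneg _))
      rw [norm_smul]
      exact mul_le_of_le_one_right (norm_nonneg _) ContinuousLinearMap.norm_id_le)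

end Projective

/-- An element of `ℓ^p_n ⊗ X` is determined by its `n` coordinates in `X`. -/
theorem Ellp.eq_zero_of_coord {p : ℝ≥0∞} [Fact (1 ≤ p)] {X : Type*} [NormedAddCommGroup X]
    [NormedSpace ℝ X] {n : ℕ} (t : Ellp p n ⊗[ℝ] X)
    (h : ∀ (k : Fin n) (g : StrongDual ℝ X), TensorProduct.dualDistrib ℝ (Ellp p n) X
      ((PiLp.proj p (fun _ : Fin n => ℝ) k : StrongDual ℝ (Ellp p n)).toLinearMap ⊗ₜ[ℝ]
        g.toLinearMap) t = 0) : t = 0 := by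
  let c (k : Fin n) : Ellp p n ⊗[ℝ] X →ₗ[ℝ] X := (TensorProduct.lid ℝ X).toLinearMap ∘ₗ
    LinearMap.rTensor X (PiLp.proj p (fun _ : Fin n => ℝ) k : StrongDual ℝ (Ellp p n)).toLinearMap
  have hrep : ∀ s : Ellp p n ⊗[ℝ] X,
      s = ∑ k, (PiLp.single p k (1 : ℝ) : Ellp p n) ⊗ₜ[ℝ] c k s := by
    intro s
    induction s with
    | zero => simp
    | tmul a x =>
      have ha : a = ∑ k, a k • (PiLp.single p k (1 : ℝ) : Ellp p n) := by
        ext i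
        simp [Pi.single_apply]
      conv_lhs => rw [ha]
      simp [c, TensorProduct.sum_tmul, TensorProduct.smul_tmul]
    | add s s' hs hs' =>
      conv_lhs => rw [hs, hs']
      simp [TensorProduct.tmul_add, Finset.sum_add_distrib]
  have hg : ∀ (k : Fin n) (g : StrongDual ℝ X) (s : Ellp p n ⊗[ℝ] X),
      TensorProduct.dualDistrib ℝ (Ellp p n) X
      ((PiLp.proj p (fun _ : Fin n => ℝ) k : StrongDual ℝ (Ellp p n)).toLinearMap ⊗ₜ[ℝ]
        g.toLinearMap) s = g (c k s) := by
    intro k g s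
    induction s with
    | zero => simp
    | tmul a x => simp [c, TensorProduct.dualDistrib_apply]
    | add s s' hs hs' => simp only [map_add, hs, hs']
  have hc : ∀ k, c k t = 0 := fun k =>
    SeparatingDual.eq_zero_of_forall_dual_eq_zero (R := ℝ) fun g => by rw [← hg k g t, h k g]
  rw [hrep t]
  simp [hc]

/-- A seminorm on `ℓ^p_n ⊗ X` that dominates the injective norm is a norm. -/
theorem Ellp.eq_zero_of_dual_le {p : ℝ≥0∞} [Fact (1 ≤ p)] {X : Type*} [NormedAddCommGroup X]
    [NormedSpace ℝ X] {n : ℕ} (t : Ellp p n ⊗[ℝ] X)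
    (h : ∀ (f : StrongDual ℝ (Ellp p n)) (g : StrongDual ℝ X), ‖f‖ ≤ 1 → ‖g‖ ≤ 1 →
      |TensorProduct.dualDistrib ℝ (Ellp p n) X (f.toLinearMap ⊗ₜ[ℝ] g.toLinearMap) t| ≤ 0) :
    t = 0 := by
  refine Ellp.eq_zero_of_coord t fun k g => ?_
  set f : StrongDual ℝ (Ellp p n) := PiLp.proj p (fun _ : Fin n => ℝ) k
  have hf : 0 < (‖f‖ + 1)⁻¹ := by positivity
  have hg : 0 < (‖g‖ + 1)⁻¹ := by positivity
  have key := h ((‖f‖ + 1)⁻¹ • f) ((‖g‖ + 1)⁻¹ • g)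
    (by rw [norm_smul, Real.norm_of_nonneg hf.le, inv_mul_le_iff₀ (by positivity)]; linarith)
    (by rw [norm_smul, Real.norm_of_nonneg hg.le, inv_mul_le_iff₀ (by positivity)]; linarith)
  have e : (((‖f‖ + 1)⁻¹ • f).toLinearMap ⊗ₜ[ℝ] ((‖g‖ + 1)⁻¹ • g).toLinearMap) =
      ((‖f‖ + 1)⁻¹ * (‖g‖ + 1)⁻¹) • (f.toLinearMap ⊗ₜ[ℝ] g.toLinearMap) := by
    rw [ContinuousLinearMap.toLinearMap_smul, ContinuousLinearMap.toLinearMap_smul,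
      TensorProduct.smul_tmul_smul]
  rw [e, map_smul, LinearMap.smul_apply, smul_eq_mul] at key
  have := abs_nonpos_iff.mp key
  exact (mul_eq_zero.mp this).resolve_left (mul_pos hf hg).ne'

/-- The maximal `p`-multinormed space `max_p(E)`: the norm on `ℓ^p_n ⊗ E` is the projective
tensor norm. -/
def maxPMultinorm (p : ℝ≥0∞) [Fact (1 ≤ p)] (E : Type*) [NormedAddCommGroup E] [NormedSpace ℝ E]
    [CompleteSpace E] : PMultinorm p E where
  nrm n := projSeminorm (Ellp p n) E
  eq_zero _ t ht := Ellp.eq_zero_of_dual_le t fun f g hf hg =>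
    (dual_le_projNorm f g hf hg t).trans (le_of_eq ht)
  cross _ a x := projNorm_tmul a x
  dual_le _ f g hf hg t := dual_le_projNorm f g hf hg t
  tensorial _ _ T t := projNorm_map_le T t

/-! ### The `ℓ^∞` sum -/

section Sum

variable {I : Type*} (X : I → Type*) [∀ i, NormedAddCommGroup (X i)] [∀ i, NormedSpace ℝ (X i)]

/-- The `i`-th coordinate map of the Banach space `ℓ^∞` sum. -/
def linftyCoord (i : I) : lp X ∞ →ₗ[ℝ] X i where
  toFun x := x i
  map_add' _ _ := rfl
  map_smul' _ _ := rfl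

variable {X} [∀ i, CompleteSpace (X i)] {p : ℝ≥0∞} [Fact (1 ≤ p)]

/-- The norm `sup_i ‖t_i‖` on `ℓ^p_n ⊗ (∑ X_i)_∞`, where `t_i ∈ ℓ^p_n ⊗ X_i` are the coordinates
of `t`. -/
def linftyNorm (α : ∀ i, PMultinorm p (X i)) (n : ℕ) (t : Ellp p n ⊗[ℝ] lp X ∞) : ℝ :=
  ⨆ i, (α i).nrm n (LinearMap.lTensor (Ellp p n) (linftyCoord X i) t)

theorem linftyNorm_bddAbove (α : ∀ i, PMultinorm p (X i)) (n : ℕ) (t : Ellp p n ⊗[ℝ] lp X ∞) :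
    BddAbove (Set.range fun i =>
      (α i).nrm n (LinearMap.lTensor (Ellp p n) (linftyCoord X i) t)) := by
  induction t with
  | zero => exact ⟨0, by rintro _ ⟨i, rfl⟩; simp⟩
  | tmul a x =>
    refine ⟨‖a‖ * ‖x‖, ?_⟩
    rintro _ ⟨i, rfl⟩
    simp only [LinearMap.lTensor_tmul, (α i).cross]
    exact mul_le_mul_of_nonneg_left (lp.norm_apply_le_norm ENNReal.top_ne_zero x i) (norm_nonneg _)
  | add s t hs ht =>
    obtain ⟨A, hA⟩ := hs
    obtain ⟨B, hB⟩ := ht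
    refine ⟨A + B, ?_⟩
    rintro _ ⟨i, rfl⟩
    simp only [map_add]
    exact (map_add_le_add _ _ _).trans (add_le_add (hA ⟨i, rfl⟩) (hB ⟨i, rfl⟩))

theorem le_linftyNorm (α : ∀ i, PMultinorm p (X i)) (n : ℕ) (t : Ellp p n ⊗[ℝ] lp X ∞) (i : I) :
    (α i).nrm n (LinearMap.lTensor (Ellp p n) (linftyCoord X i) t) ≤ linftyNorm α n t :=
  le_ciSup (linftyNorm_bddAbove α n t) i

theorem linftyNorm_nonneg (α : ∀ i, PMultinorm p (X i)) (n : ℕ) (t : Ellp p n ⊗[ℝ] lp X ∞) :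
    0 ≤ linftyNorm α n t :=
  Real.iSup_nonneg fun _ => apply_nonneg _ _

theorem linftyNorm_le (α : ∀ i, PMultinorm p (X i)) (n : ℕ) (t : Ellp p n ⊗[ℝ] lp X ∞) {C : ℝ}
    (hC : 0 ≤ C)
    (h : ∀ i, (α i).nrm n (LinearMap.lTensor (Ellp p n) (linftyCoord X i) t) ≤ C) :
    linftyNorm α n t ≤ C :=
  Real.iSup_le h hC

theorem linftyNorm_dual_le (α : ∀ i, PMultinorm p (X i)) (n : ℕ) (f : StrongDual ℝ (Ellp p n))
    (g : StrongDual ℝ (lp X ∞)) (hf : ‖f‖ ≤ 1) (hg : ‖g‖ ≤ 1) (t : Ellp p n ⊗[ℝ] lp X ∞) :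
    |TensorProduct.dualDistrib ℝ (Ellp p n) (lp X ∞) (f.toLinearMap ⊗ₜ[ℝ] g.toLinearMap) t| ≤
      linftyNorm α n t := by
  let c : Ellp p n ⊗[ℝ] lp X ∞ →ₗ[ℝ] lp X ∞ := (TensorProduct.lid ℝ _).toLinearMap ∘ₗ
    LinearMap.rTensor _ f.toLinearMap
  have h1 : TensorProduct.dualDistrib ℝ (Ellp p n) (lp X ∞)
      (f.toLinearMap ⊗ₜ[ℝ] g.toLinearMap) t = g (c t) := by
    induction t with
    | zero => simp
    | tmul a x => simp [c, TensorProduct.dualDistrib_apply]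
    | add s s' hs hs' => simp only [map_add, hs, hs']
  have h2 : ∀ (i : I) (h : StrongDual ℝ (X i)), TensorProduct.dualDistrib ℝ (Ellp p n) (X i)
      (f.toLinearMap ⊗ₜ[ℝ] h.toLinearMap)
        (LinearMap.lTensor (Ellp p n) (linftyCoord X i) t) = h (linftyCoord X i (c t)) := by
    intro i h
    clear h1
    induction t with
    | zero => simp
    | tmul a x => simp [c, TensorProduct.dualDistrib_apply]
    | add s s' hs hs' => simp only [map_add, hs, hs']
  have h3 : ‖c t‖ ≤ linftyNorm α n t := by
    refine lp.norm_le_of_forall_le (linftyNorm_nonneg α n t) fun i => ?_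
    obtain ⟨h, hh, hx⟩ := exists_dual_vector'' ℝ (linftyCoord X i (c t))
    have h4 := (α i).dual_le n f h hf hh (LinearMap.lTensor (Ellp p n) (linftyCoord X i) t)
    rw [h2, hx] at h4
    exact (le_abs_self _).trans (h4.trans (le_linftyNorm α n t i))
  rw [h1]
  have h5 : ‖g (c t)‖ ≤ ‖c t‖ := by simpa using g.le_of_opNorm_le hg (c t)
  exact h5.trans h3

/-- The `ℓ^∞` sum `(∑ X_i)_∞` of `p`-multinormed spaces. -/
def linftySum (α : ∀ i, PMultinorm p (X i)) : PMultinorm p (lp X ∞) where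
  nrm n := Seminorm.ofSMulLE (linftyNorm α n)
    (le_antisymm (linftyNorm_le α n 0 le_rfl fun i => by simp) (linftyNorm_nonneg α n 0))
    (fun s t => linftyNorm_le α n _ (add_nonneg (linftyNorm_nonneg α n s) (linftyNorm_nonneg α n t))
      fun i => by
        rw [map_add]
        exact (map_add_le_add _ _ _).trans
          (add_le_add (le_linftyNorm α n s i) (le_linftyNorm α n t i)))
    (fun c t => linftyNorm_le α n _ (mul_nonneg (norm_nonneg c) (linftyNorm_nonneg α n t))
      fun i => by
        rw [map_smul, map_smul_eq_mul]
        exact mul_le_mul_of_nonneg_left (le_linftyNorm α n t i) (norm_nonneg c))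
  eq_zero n t ht := Ellp.eq_zero_of_dual_le t fun f g hf hg =>
    (linftyNorm_dual_le α n f g hf hg t).trans (le_of_eq ht)
  cross n a x := by
    change linftyNorm α n (a ⊗ₜ[ℝ] x) = ‖a‖ * ‖x‖
    refine le_antisymm (linftyNorm_le α n _ (by positivity) fun i => ?_) ?_
    · rw [LinearMap.lTensor_tmul, (α i).cross]
      exact mul_le_mul_of_nonneg_left (lp.norm_apply_le_norm ENNReal.top_ne_zero x i)
        (norm_nonneg _)
    · obtain ⟨f, hf, hfa⟩ := exists_dual_vector'' ℝ a
      obtain ⟨g, hg, hgx⟩ := exists_dual_vector'' ℝ x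
      have := linftyNorm_dual_le α n f g hf hg (a ⊗ₜ[ℝ] x)
      simpa [TensorProduct.dualDistrib_apply, hfa, hgx] using this
  dual_le n f g hf hg t := linftyNorm_dual_le α n f g hf hg t
  tensorial n m T t := by
    refine linftyNorm_le α m _ (mul_nonneg (norm_nonneg T) (linftyNorm_nonneg α n t)) fun i => ?_
    have h : LinearMap.lTensor (Ellp p m) (linftyCoord X i)
        (LinearMap.rTensor (lp X ∞) T.toLinearMap t) =
        LinearMap.rTensor (X i) T.toLinearMap
          (LinearMap.lTensor (Ellp p n) (linftyCoord X i) t) := by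
      rw [← LinearMap.comp_apply, ← LinearMap.comp_apply, LinearMap.lTensor_comp_rTensor,
        LinearMap.rTensor_comp_lTensor]
    rw [h]
    exact ((α i).tensorial n m T _).trans
      (mul_le_mul_of_nonneg_left (le_linftyNorm α n t i) (norm_nonneg T))

end Sum

end

/-! The proof linearizes the extension problem and applies Hahn–Banach. Put `E = L^p(μ)` and regard
`Z = L^{p'}(μ)` as a subspace of the dual `E^*`. A map `u : X → Z` is the same as the functional `f
⊗ x ↦ ⟨u x, f⟩` on `E ⊗ X`. On `E ⊗ Y` take the seminorm `sup ‖(T ⊗ I)t‖` over all contractions `T :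
E → ℓ^p_n`. The averaging operators over finitely many disjoint sets factor through `ℓ^p_n` by
contractions and approximate the identity of `E` well enough for the pairing with `Z`. Hence the
functional of `u` is bounded by `‖u‖_p` times this seminorm, and it extends to `E ⊗ Y` with the same
bound. The extension is a map `Y → E^*`.

Its `p`-norm is controlled by duality: on `ℓ^p_n ⊗ E^*` the projective norm is the supremum of the
pairings with contractions `S : ℓ^p_n → E` (`Ellp.projNorm_le_of_operatorPairing_le`). For such `S`,
every `T ∘ S` is a contraction `ℓ^p_n → ℓ^p_m`, and the tensorial property of `Y` applies. A
contractive retraction `E^* → Z` then brings the values back to `Z`. This is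
`isInjective_max_of_dual_retract`.

The retraction is Riesz duality when `p < ∞`; `σ`-finiteness is needed only for `p = 1`, since for
`1 < p < ∞` each functional lives on a `σ`-finite set. For `p = ∞` it is the projection of `(L^∞)^*`
onto `L^1` which discards the singular part of a finitely additive measure (Yosida–Hewitt, then
Radon–Nikodym), and it exists for every measure. The spaces `ℓ^{p'}_n` come from counting measure,
and an `ℓ^∞`-sum is treated coordinate by coordinate. -/

theorem Ellp.eq_sum_single_tmul {p : ℝ≥0∞} [Fact (1 ≤ p)] {M : Type*} [AddCommGroup M]
    [Module ℝ M] {n : ℕ} (t : Ellp p n ⊗[ℝ] M) :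
    ∃ x : Fin n → M, t = ∑ k, (PiLp.single p k (1 : ℝ) : Ellp p n) ⊗ₜ[ℝ] x k := by
  induction t with
  | zero => exact ⟨0, by simp⟩
  | tmul a x =>
    refine ⟨fun k => a k • x, ?_⟩
    have ha : a = ∑ k, a k • (PiLp.single p k (1 : ℝ) : Ellp p n) := by
      ext i
      simp [Pi.single_apply]
    conv_lhs => rw [ha]
    simp [TensorProduct.sum_tmul, TensorProduct.smul_tmul]
  | add s t hs ht =>
    obtain ⟨x, rfl⟩ := hs
    obtain ⟨y, rfl⟩ := ht
    exact ⟨x + y, by simp [TensorProduct.tmul_add, Finset.sum_add_distrib]⟩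

/-! ### Duality between the projective norm on `ℓ^p_n ⊗ E^*` and operators `ℓ^p_n → E`. -/

section Projective

variable {E F G : Type*} [NormedAddCommGroup E] [NormedSpace ℝ E]
  [NormedAddCommGroup F] [NormedSpace ℝ F] [NormedAddCommGroup G] [NormedSpace ℝ G]

theorem TensorProduct.exists_eq_sum_tmul (t : E ⊗[ℝ] F) :
    ∃ (k : ℕ) (a : Fin k → E) (x : Fin k → F), t = ∑ i, a i ⊗ₜ[ℝ] x i := by
  obtain ⟨r, k, a, x, h, -⟩ := projCosts_nonempty t
  exact ⟨k, a, x, h⟩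

theorem projNorm_lTensor_le (R : F →ₗ[ℝ] G) (hR : ∀ x, ‖R x‖ ≤ ‖x‖) (t : E ⊗[ℝ] F) :
    projNorm (LinearMap.lTensor E R t) ≤ projNorm t := by
  refine le_csInf (projCosts_nonempty t) ?_
  rintro r ⟨k, a, x, rfl, rfl⟩
  refine (projNorm_le ⟨k, a, fun i => R (x i), by simp, rfl⟩).trans ?_
  exact Finset.sum_le_sum fun i _ => mul_le_mul_of_nonneg_left (hR _) (norm_nonneg _)

/-- A bilinear form of norm at most one is dominated by the projective norm. -/
theorem lift_le_projNorm (b : E →ₗ[ℝ] F →ₗ[ℝ] ℝ) (hb : ∀ a x, b a x ≤ ‖a‖ * ‖x‖)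
    (t : E ⊗[ℝ] F) : TensorProduct.lift b t ≤ projNorm t := by
  refine le_csInf (projCosts_nonempty t) ?_
  rintro r ⟨k, a, x, rfl, rfl⟩
  simpa using Finset.sum_le_sum fun i _ => hb (a i) (x i)

/-- The pairing of an operator `S : G → E` with `G ⊗ E^*`. -/
def operatorPairing (S : G →L[ℝ] E) : G ⊗[ℝ] StrongDual ℝ E →ₗ[ℝ] ℝ :=
  TensorProduct.lift (LinearMap.mk₂ ℝ (fun a f => f (S a)) (by simp) (by simp) (by simp)
    (by simp))

@[simp] theorem operatorPairing_tmul (S : G →L[ℝ] E) (a : G) (f : StrongDual ℝ E) :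
    operatorPairing S (a ⊗ₜ[ℝ] f) = f (S a) := by
  simp [operatorPairing]

theorem operatorPairing_add (S T : G →L[ℝ] E) (w : G ⊗[ℝ] StrongDual ℝ E) :
    operatorPairing (S + T) w = operatorPairing S w + operatorPairing T w := by
  induction w with
  | zero => simp
  | tmul a f => simp
  | add s t hs ht => simp only [map_add, hs, ht]; ring

theorem operatorPairing_smul (c : ℝ) (S : G →L[ℝ] E) (w : G ⊗[ℝ] StrongDual ℝ E) :
    operatorPairing (c • S) w = c * operatorPairing S w := by
  induction w with
  | zero => simp
  | tmul a f => simp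
  | add s t hs ht => simp only [map_add, hs, ht]; ring

/-- The rank-one operators `a ↦ a_k e` already read off the value at `e` of the `k`-th coordinate
functional. -/
theorem Ellp.eq_of_operatorPairing {p : ℝ≥0∞} [Fact (1 ≤ p)] {n : ℕ}
    {w w' : Ellp p n ⊗[ℝ] StrongDual ℝ E}
    (h : ∀ S : Ellp p n →L[ℝ] E, operatorPairing S w = operatorPairing S w') : w = w' := by
  rw [← sub_eq_zero]
  obtain ⟨x, hx⟩ := Ellp.eq_sum_single_tmul (w - w')
  rw [hx]
  refine Finset.sum_eq_zero fun k _ => ?_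
  suffices x k = 0 by rw [this, TensorProduct.tmul_zero]
  ext e
  have h1 := h ((PiLp.proj p (fun _ : Fin n => ℝ) k : StrongDual ℝ (Ellp p n)).smulRight e)
  rw [← sub_eq_zero, ← map_sub, hx] at h1
  have h2 : ∀ j, x j (if k = j then e else 0) = if k = j then x j e else 0 := fun j => by
    split_ifs <;> simp
  simpa [Pi.single_apply, h2] using h1

/-- The dual of a finite `ℓ^∞`-power of `E` is the `ℓ^1`-power of the dual of `E`. -/
theorem sum_norm_comp_single_le {A : Type*} [Fintype A] [DecidableEq A]
    (Ψ : StrongDual ℝ (A → E)) :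
    ∑ a, ‖Ψ ∘L ContinuousLinearMap.single ℝ (fun _ : A => E) a‖ ≤ ‖Ψ‖ := by
  refine le_of_forall_pos_le_add fun ε hε => ?_
  set δ : ℝ := ε / (Fintype.card A + 1)
  have hδ : 0 < δ := by positivity
  -- Vectors that almost norm the separate components, with the sign chosen to make the value
  -- positive, form one vector of sup norm at most one on which `Ψ` is almost the sum of the norms.
  have hx : ∀ a, ∃ x : E, ‖x‖ ≤ 1 ∧
      ‖Ψ ∘L ContinuousLinearMap.single ℝ (fun _ : A => E) a‖ - δ ≤ Ψ (Pi.single a x) := by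
    intro a
    obtain ⟨x, hx, hx'⟩ := ContinuousLinearMap.exists_lt_apply_of_lt_opNorm
      (Ψ ∘L ContinuousLinearMap.single ℝ (fun _ : A => E) a) (sub_lt_self _ hδ)
    simp only [ContinuousLinearMap.comp_apply, ContinuousLinearMap.single_apply,
      Real.norm_eq_abs] at hx'
    rcases le_abs.mp hx'.le with h | h
    · exact ⟨x, hx.le, h⟩
    · exact ⟨-x, by simpa using hx.le, by simpa [Pi.single_neg] using h⟩
  choose x hx hx' using hx
  have h1 : Ψ x = ∑ a, Ψ (Pi.single a (x a)) := by
    rw [← map_sum, Finset.univ_sum_single]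
  have h2 : Ψ x ≤ ‖Ψ‖ := by
    refine (le_abs_self _).trans ((Ψ.le_opNorm x).trans ?_)
    exact mul_le_of_le_one_right (norm_nonneg _) ((pi_norm_le_iff_of_nonneg zero_le_one).2 hx)
  have h3 : ∑ a, (‖Ψ ∘L ContinuousLinearMap.single ℝ (fun _ : A => E) a‖ - δ) ≤ ‖Ψ‖ :=
    (Finset.sum_le_sum fun a _ => hx' a).trans (h1.symm.le.trans h2)
  rw [Finset.sum_sub_distrib, Finset.sum_const, Finset.card_univ, nsmul_eq_mul] at h3
  have h4 : (Fintype.card A : ℝ) * δ ≤ ε := by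
    rw [mul_div_assoc', div_le_iff₀ (by positivity)]
    nlinarith
  linarith

/-- On `ℓ^p_n ⊗ E^*` the projective norm is the supremum of the pairings with contractions
`ℓ^p_n → E`. -/
theorem Ellp.projNorm_le_of_operatorPairing_le {p : ℝ≥0∞} [Fact (1 ≤ p)] {n : ℕ}
    (w : Ellp p n ⊗[ℝ] StrongDual ℝ E) {M : ℝ}
    (h : ∀ S : Ellp p n →L[ℝ] E, ‖S‖ ≤ 1 → operatorPairing S w ≤ M) : projNorm w ≤ M := by
  classical
  have hM : 0 ≤ M := by
    have := h 0 (by simp)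
    have h0 := operatorPairing_smul (0 : ℝ) (0 : Ellp p n →L[ℝ] E) w
    rw [zero_smul, zero_mul] at h0
    rwa [h0] at this
  -- Replacing the unit ball of `ℓ^p_n` by a finite `ε`-net costs a factor `1 - ε`, which disappears
  -- in the limit.
  suffices key : ∀ ε : ℝ, 0 < ε → ε < 1 → (1 - ε) * projNorm w ≤ M by
    have hlim : Filter.Tendsto (fun ε : ℝ => (1 - ε) * projNorm w) (nhdsWithin 0 (Set.Ioi 0))
        (nhds ((1 - 0) * projNorm w)) :=
      ((continuous_const.sub continuous_id).mul continuous_const).continuousAt.mono_left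
        nhdsWithin_le_nhds
    rw [sub_zero, one_mul] at hlim
    refine le_of_tendsto hlim ?_
    filter_upwards [Ioo_mem_nhdsGT (zero_lt_one (α := ℝ))] with ε hε using key ε hε.1 hε.2
  intro ε hε hε1
  have hcpt : IsCompact (Metric.closedBall (0 : Ellp p n) 1) := isCompact_closedBall _ _
  obtain ⟨A, hAs, hAf, hA⟩ := hcpt.finite_cover_balls hε
  have : Fintype A := hAf.fintype
  -- evaluation on the net is bounded below
  have hnet : ∀ (S : Ellp p n →L[ℝ] E) (r : ℝ), 0 ≤ r → (∀ a : A, ‖S a‖ ≤ r) →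
      (1 - ε) * ‖S‖ ≤ r := by
    intro S r hr hS
    suffices ‖S‖ ≤ r + ε * ‖S‖ by linarith
    refine ContinuousLinearMap.opNorm_le_of_unit_norm (by positivity) fun x hx => ?_
    have hx' := hA (show x ∈ Metric.closedBall (0 : Ellp p n) 1 by simp [hx])
    simp only [Set.mem_iUnion] at hx'
    obtain ⟨a, ha, hax⟩ := hx'
    have h1 : S x = S a + S (x - a) := by simp
    rw [h1]
    refine (norm_add_le _ _).trans (add_le_add (hS ⟨a, ha⟩) ?_)
    refine (S.le_opNorm _).trans ?_
    rw [mul_comm]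
    exact mul_le_mul_of_nonneg_right (by rw [← dist_eq_norm]; exact (Metric.mem_ball.1 hax).le)
      (norm_nonneg _)
  -- Evaluation on the net embeds the operators into the `ℓ^∞`-power `E^A`, with lower bound `1 -
  -- ε`.
  let Φ : (Ellp p n →L[ℝ] E) →ₗ[ℝ] (A → E) :=
    { toFun := fun S a => S a, map_add' := fun _ _ => rfl, map_smul' := fun _ _ => rfl }
  have hΦ : ∀ S, (1 - ε) * ‖S‖ ≤ ‖Φ S‖ := fun S =>
    hnet S _ (norm_nonneg _) fun a => norm_le_pi_norm (Φ S) a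
  have hΦinj : Function.Injective Φ := by
    rw [injective_iff_map_eq_zero]
    intro S hS
    have := hΦ S
    rw [hS, norm_zero] at this
    rw [← norm_le_zero_iff]
    nlinarith [norm_nonneg S]
  obtain ⟨L, hL⟩ := Φ.exists_leftInverse_of_injective (LinearMap.ker_eq_bot.2 hΦinj)
  have hL' : ∀ S, L (Φ S) = S := fun S => LinearMap.congr_fun hL S
  let pw : (Ellp p n →L[ℝ] E) →ₗ[ℝ] ℝ :=
    { toFun := fun S => operatorPairing S w
      map_add' := fun S T => operatorPairing_add S T w
      map_smul' := fun c S => operatorPairing_smul c S w }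
  have hpw : ∀ S, pw S ≤ M * ‖S‖ := by
    intro S
    rcases eq_or_ne S 0 with rfl | hS
    · simp
    have hn : 0 < ‖S‖ := norm_pos_iff.2 hS
    have := h (‖S‖⁻¹ • S) (by rw [norm_smul, norm_inv, norm_norm, inv_mul_cancel₀ hn.ne'])
    rw [operatorPairing_smul, inv_mul_le_iff₀ hn] at this
    linarith [show pw S = operatorPairing S w from rfl]
  have h1ε : 0 < 1 - ε := by linarith
  have hpw' : ∀ S, pw S ≤ M / (1 - ε) * ‖Φ S‖ := by
    intro S
    refine (hpw S).trans ?_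
    rw [div_mul_eq_mul_div, le_div_iff₀ h1ε]
    nlinarith [hΦ S]
  -- Extend the pairing with `w` from the image of `Φ` to all of `E^A`. The components of the
  -- extension are functionals on `E` with norms summing to at most `M / (1 - ε)`, and attached to
  -- the points of the net they represent `w` at that cost.
  obtain ⟨g, hg, hgN⟩ := exists_extension_of_le_sublinear
    ⟨LinearMap.range Φ, (pw ∘ₗ L) ∘ₗ (LinearMap.range Φ).subtype⟩
    (fun x => M / (1 - ε) * ‖x‖)
    (fun c hc x => by rw [norm_smul, Real.norm_of_nonneg hc.le]; ring)
    (fun x y => by rw [← mul_add]; exact mul_le_mul_of_nonneg_left (norm_add_le _ _) (by positivity))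
    (by
      rintro ⟨_, S, rfl⟩
      change pw (L (Φ S)) ≤ _
      rw [hL']
      exact hpw' S)
  have hgΦ : ∀ S, g (Φ S) = operatorPairing S w := fun S => by
    have := hg ⟨Φ S, S, rfl⟩
    refine this.trans ?_
    change pw (L (Φ S)) = _
    rw [hL']; rfl
  let Ψ : StrongDual ℝ (A → E) := g.mkContinuous (M / (1 - ε)) fun x => by
    rw [Real.norm_eq_abs, abs_le]
    refine ⟨?_, hgN x⟩
    have := hgN (-x)
    rw [map_neg, norm_neg] at this
    linarith
  have hΨ : ‖Ψ‖ ≤ M / (1 - ε) := g.mkContinuous_norm_le (by positivity) _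
  have hw : w = ∑ a : A, (a : Ellp p n) ⊗ₜ[ℝ]
      (Ψ ∘L ContinuousLinearMap.single ℝ (fun _ : A => E) a) := by
    refine Ellp.eq_of_operatorPairing fun S => ?_
    rw [← hgΦ, map_sum]
    conv_lhs => rw [← Finset.univ_sum_single (Φ S)]
    rw [map_sum]
    refine Finset.sum_congr rfl fun a _ => ?_
    simp [Ψ, Φ]
  have hle : projNorm w ≤ M / (1 - ε) := by
    refine le_trans ?_ ((sum_norm_comp_single_le Ψ).trans hΨ)
    let e := (Fintype.equivFin A).symm
    refine (projNorm_le ⟨Fintype.card A, fun i => (e i : Ellp p n), fun i =>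
      Ψ ∘L ContinuousLinearMap.single ℝ (fun _ : A => E) (e i), ?_, rfl⟩).trans ?_
    · rw [e.sum_comp (fun a : A => (a : Ellp p n) ⊗ₜ[ℝ]
        (Ψ ∘L ContinuousLinearMap.single ℝ (fun _ : A => E) a))]
      exact hw
    · rw [e.sum_comp (fun a : A => ‖(a : Ellp p n)‖ *
        ‖Ψ ∘L ContinuousLinearMap.single ℝ (fun _ : A => E) a‖)]
      refine Finset.sum_le_sum fun a _ => mul_le_of_le_one_left (norm_nonneg _) ?_
      simpa using hAs a.2
  rwa [le_div_iff₀ h1ε, mul_comm] at hle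

end Projective

noncomputable section

namespace PMultinorm

/-! ### Estimates for multibounded maps. -/

section Basic

variable {p : ℝ≥0∞} [Fact (1 ≤ p)]
  {X : Type*} [NormedAddCommGroup X] [NormedSpace ℝ X] [CompleteSpace X]
  {Y : Type*} [NormedAddCommGroup Y] [NormedSpace ℝ Y] [CompleteSpace Y]
  {Z : Type*} [NormedAddCommGroup Z] [NormedSpace ℝ Z] [CompleteSpace Z]

theorem nrm_lTensor_le_of_isMultibounded {α : PMultinorm p X} {β : PMultinorm p Y}
    {u : X →ₗ[ℝ] Y} (hu : IsMultibounded α β u) (n : ℕ) (t : Ellp p n ⊗[ℝ] X) :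
    β.nrm n (LinearMap.lTensor (Ellp p n) u t) ≤ (pNorm α β u).toReal * α.nrm n t := by
  rcases eq_or_ne (α.nrm n t) 0 with h0 | h0
  · rw [α.eq_zero n t h0]; simp
  have hpos : 0 < α.nrm n t := lt_of_le_of_ne (apply_nonneg _ _) (Ne.symm h0)
  have h1 : α.nrm n ((α.nrm n t)⁻¹ • t) ≤ 1 := by
    rw [map_smul_eq_mul, norm_inv, Real.norm_of_nonneg hpos.le, inv_mul_cancel₀ h0]
  have h2 : ENNReal.ofReal (β.nrm n (LinearMap.lTensor (Ellp p n) u ((α.nrm n t)⁻¹ • t))) ≤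
      pNorm α β u :=
    le_iSup_of_le n (le_iSup_of_le _ (le_iSup_of_le h1 le_rfl))
  have h3 := (ENNReal.ofReal_le_iff_le_toReal hu.ne).1 h2
  rw [map_smul, map_smul_eq_mul, norm_inv, Real.norm_of_nonneg hpos.le,
    inv_mul_le_iff₀ hpos] at h3
  linarith

theorem pNorm_le_of_forall_nrm_le {α : PMultinorm p X} {β : PMultinorm p Y} {u : X →ₗ[ℝ] Y}
    {C : ℝ} (hC : 0 ≤ C)
    (h : ∀ n t, β.nrm n (LinearMap.lTensor (Ellp p n) u t) ≤ C * α.nrm n t) :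
    pNorm α β u ≤ ENNReal.ofReal C :=
  iSup_le fun n => iSup_le fun t => iSup_le fun ht => ENNReal.ofReal_le_ofReal <|
    (h n t).trans (mul_le_of_le_one_right hC ht)

/-- Tensoring with a unit vector of `ℓ^p_1` embeds `X` isometrically in `ℓ^p_1 ⊗ X`, so bounds on
the case `n = 1` are bounds on `X` itself. -/
theorem exists_norm_eq_one (p : ℝ≥0∞) [Fact (1 ≤ p)] : ∃ a : Ellp p 1, ‖a‖ = 1 :=
  exists_norm_eq (Ellp p 1) zero_le_one

theorem norm_le_of_isMultibounded {α : PMultinorm p X} {β : PMultinorm p Y}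
    {u : X →ₗ[ℝ] Y} (hu : IsMultibounded α β u) (x : X) :
    ‖u x‖ ≤ (pNorm α β u).toReal * ‖x‖ := by
  obtain ⟨a, ha⟩ := exists_norm_eq_one p
  simpa [α.cross, β.cross, ha] using nrm_lTensor_le_of_isMultibounded hu 1 (a ⊗ₜ[ℝ] x)

theorem IsMultiIsometry.norm_map {α : PMultinorm p X} {β : PMultinorm p Y}
    {j : X →ₗ[ℝ] Y} (hj : IsMultiIsometry α β j) (x : X) : ‖j x‖ = ‖x‖ := by
  obtain ⟨a, ha⟩ := exists_norm_eq_one p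
  simpa [α.cross, β.cross, ha] using hj 1 (a ⊗ₜ[ℝ] x)

theorem IsMultiIsometry.injective {α : PMultinorm p X} {β : PMultinorm p Y}
    {j : X →ₗ[ℝ] Y} (hj : IsMultiIsometry α β j) : Function.Injective j := by
  rw [injective_iff_map_eq_zero]
  intro x hx
  rw [← norm_eq_zero, ← hj.norm_map, hx, norm_zero]

theorem pNorm_comp_le (α : PMultinorm p X) {β : PMultinorm p Y} {γ : PMultinorm p Z}
    (u : X →ₗ[ℝ] Y) {w : Y →ₗ[ℝ] Z}
    (hw : ∀ n t, γ.nrm n (LinearMap.lTensor (Ellp p n) w t) ≤ β.nrm n t) :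
    pNorm α γ (w ∘ₗ u) ≤ pNorm α β u := by
  refine iSup_mono fun n => iSup_mono fun t => iSup_mono fun _ => ENNReal.ofReal_le_ofReal ?_
  rw [LinearMap.lTensor_comp, LinearMap.comp_apply]
  exact hw n _

end Basic

/-! ### The Hahn–Banach extension argument. -/

section Extension

variable {p : ℝ≥0∞} [Fact (1 ≤ p)]
  {E : Type*} [NormedAddCommGroup E] [NormedSpace ℝ E]
  {Y : Type*} [NormedAddCommGroup Y] [NormedSpace ℝ Y] [CompleteSpace Y]

variable (E) in
/-- The seminorm on `E ⊗ Y` induced by all contractions `E → ℓ^p_n`. -/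
def extSeminorm (β : PMultinorm p Y) : Seminorm ℝ (E ⊗[ℝ] Y) :=
  ⨆ i : Σ n : ℕ, {T : E →L[ℝ] Ellp p n // ‖T‖ ≤ 1},
    (β.nrm i.1).comp (LinearMap.rTensor Y i.2.1.toLinearMap)

theorem nrm_rTensor_sum_le (β : PMultinorm p Y) {n : ℕ} {T : E →L[ℝ] Ellp p n} (hT : ‖T‖ ≤ 1)
    {k : ℕ} (a : Fin k → E) (y : Fin k → Y) :
    β.nrm n (LinearMap.rTensor Y T.toLinearMap (∑ i, a i ⊗ₜ[ℝ] y i)) ≤ ∑ i, ‖a i‖ * ‖y i‖ := by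
  simp only [map_sum, LinearMap.rTensor_tmul]
  refine (Finset.le_sum_of_subadditive (β.nrm n) (map_zero _).le (map_add_le_add _) _ _).trans (Finset.sum_le_sum fun i _ => ?_)
  rw [β.cross]
  exact mul_le_mul_of_nonneg_right (by simpa using T.le_of_opNorm_le hT (a i)) (norm_nonneg _)

/-- The supremum of an unbounded family of seminorms is zero by convention, so this is what gives
`extSeminorm` its meaning. The cost of any one representation of the tensor bounds the whole family.
-/
theorem bddAbove_extSeminorm (β : PMultinorm p Y) :
    BddAbove (Set.range fun i : Σ n : ℕ, {T : E →L[ℝ] Ellp p n // ‖T‖ ≤ 1} =>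
      (β.nrm i.1).comp (LinearMap.rTensor Y i.2.1.toLinearMap)) := by
  rw [Seminorm.bddAbove_range_iff]
  intro t
  obtain ⟨k, a, y, rfl⟩ := TensorProduct.exists_eq_sum_tmul t
  refine ⟨∑ i, ‖a i‖ * ‖y i‖, ?_⟩
  rintro _ ⟨⟨n, T, hT⟩, rfl⟩
  exact nrm_rTensor_sum_le β hT a y

theorem nrm_rTensor_le_extSeminorm (β : PMultinorm p Y) {n : ℕ} {T : E →L[ℝ] Ellp p n}
    (hT : ‖T‖ ≤ 1) (t : E ⊗[ℝ] Y) :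
    β.nrm n (LinearMap.rTensor Y T.toLinearMap t) ≤ extSeminorm E β t := by
  rw [extSeminorm, Seminorm.iSup_apply (bddAbove_extSeminorm β)]
  exact le_ciSup (f := fun i : Σ n : ℕ, {T : E →L[ℝ] Ellp p n // ‖T‖ ≤ 1} =>
      (β.nrm i.1).comp (LinearMap.rTensor Y i.2.1.toLinearMap) t)
    (Seminorm.bddAbove_range_iff.1 (bddAbove_extSeminorm β) t) ⟨n, T, hT⟩

theorem extSeminorm_le (β : PMultinorm p Y) (t : E ⊗[ℝ] Y) {C : ℝ}
    (h : ∀ (n : ℕ) (T : E →L[ℝ] Ellp p n), ‖T‖ ≤ 1 →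
      β.nrm n (LinearMap.rTensor Y T.toLinearMap t) ≤ C) : extSeminorm E β t ≤ C := by
  rw [extSeminorm, Seminorm.iSup_apply (bddAbove_extSeminorm β)]
  have : Nonempty (Σ n : ℕ, {T : E →L[ℝ] Ellp p n // ‖T‖ ≤ 1}) := ⟨⟨0, 0, by simp⟩⟩
  exact ciSup_le fun i => h i.1 i.2.1 i.2.2

theorem extSeminorm_tmul_le (β : PMultinorm p Y) (f : E) (y : Y) :
    extSeminorm E β (f ⊗ₜ[ℝ] y) ≤ ‖f‖ * ‖y‖ :=
  extSeminorm_le β _ fun n T hT => by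
    simpa using nrm_rTensor_sum_le β hT (fun _ : Fin 1 => f) (fun _ => y)

/-- The functional `f ⊗ x ↦ ⟨u x, f⟩` on `E ⊗ X`. -/
def traceForm {X : Type*} [AddCommGroup X] [Module ℝ X] (u : X →ₗ[ℝ] StrongDual ℝ E) :
    E ⊗[ℝ] X →ₗ[ℝ] ℝ :=
  TensorProduct.lift (LinearMap.mk₂ ℝ (fun f x => u x f) (by simp) (by simp) (by simp) (by simp))

@[simp] theorem traceForm_tmul {X : Type*} [AddCommGroup X] [Module ℝ X]
    (u : X →ₗ[ℝ] StrongDual ℝ E) (f : E) (x : X) : traceForm u (f ⊗ₜ[ℝ] x) = u x f := by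
  simp [traceForm]

/-- If `Z` is a contractive retract of the dual of a Banach space `E` in which, relative to `Z`, the
identity is approximated by contractions factoring through `ℓ^p_n`, then `max_p(Z)` is
`1`-injective. -/
theorem isInjective_max_of_dual_retract {Z : Type*} [NormedAddCommGroup Z] [NormedSpace ℝ Z]
    [CompleteSpace Z] (ι : Z →ₗ[ℝ] StrongDual ℝ E) (hι : ∀ z, ‖ι z‖ ≤ ‖z‖)
    (R : StrongDual ℝ E →ₗ[ℝ] Z) (hR : ∀ F, ‖R F‖ ≤ ‖F‖) (hRι : ∀ z, R (ι z) = z)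
    (happ : ∀ (k : ℕ) (f : Fin k → E) (z : Fin k → Z) (ε : ℝ), 0 < ε →
      ∃ (n : ℕ) (T : E →L[ℝ] Ellp p n) (S : Ellp p n →L[ℝ] E), ‖T‖ ≤ 1 ∧ ‖S‖ ≤ 1 ∧
        ∀ i, ι (z i) (f i) ≤ ι (z i) (S (T (f i))) + ε) :
    IsInjective (maxPMultinorm p Z) 1 := by
  intro X _ _ _ Y _ _ _ α β j hj u hu
  set γ := maxPMultinorm p Z
  set C : ℝ := (pNorm α γ u).toReal with hCdef
  have hC : 0 ≤ C := ENNReal.toReal_nonneg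
  -- Up to `ε`, `t` may be replaced by `(ST ⊗ I)t`. The functional then pairs `S` with the tensor
  -- `(I ⊗ u)(T ⊗ I)t` of `ℓ^p_n ⊗ Z`, whose projective norm is controlled by the `p`-norm of `u`.
  have hφ : ∀ t : E ⊗[ℝ] X,
      traceForm (ι ∘ₗ u) t ≤ C * extSeminorm E β (LinearMap.lTensor E j t) := by
    intro t
    obtain ⟨k, f, x, rfl⟩ := TensorProduct.exists_eq_sum_tmul t
    refine le_of_forall_pos_le_add fun ε hε => ?_
    obtain ⟨n, T, S, hT, hS, happ⟩ := happ k f (fun i => u (x i)) (ε / (k + 1)) (by positivity)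
    set t := ∑ i, f i ⊗ₜ[ℝ] x i
    have h1 : traceForm (ι ∘ₗ u) t ≤ traceForm (ι ∘ₗ u)
        (LinearMap.rTensor X (S.toLinearMap ∘ₗ T.toLinearMap) t) + ε := by
      have : (k : ℝ) * (ε / (k + 1)) ≤ ε := by
        rw [mul_div_assoc', div_le_iff₀ (by positivity)]; nlinarith
      simp only [t, map_sum, LinearMap.rTensor_tmul, traceForm_tmul, LinearMap.comp_apply]
      calc _ ≤ ∑ i, (ι (u (x i)) (S (T (f i))) + ε / (k + 1)) :=
            Finset.sum_le_sum fun i _ => happ i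
        _ ≤ _ := by
            rw [Finset.sum_add_distrib]
            simpa using this
    have h2 : ∀ s : Ellp p n ⊗[ℝ] X, traceForm (ι ∘ₗ u) (LinearMap.rTensor X S.toLinearMap s) =
        TensorProduct.lift (LinearMap.mk₂ ℝ (fun (a : Ellp p n) (z : Z) => ι z (S a))
          (by simp) (by simp) (by simp) (by simp)) (LinearMap.lTensor (Ellp p n) u s) := by
      intro s
      induction s with
      | zero => simp
      | tmul a x => simp
      | add s t hs ht => simp only [map_add, hs, ht]
    rw [LinearMap.rTensor_comp, LinearMap.comp_apply, h2] at h1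
    refine h1.trans (add_le_add_left ?_ ε)
    refine (lift_le_projNorm _ (fun a z => ?_) _).trans ?_
    · rw [LinearMap.mk₂_apply]
      refine (le_abs_self _).trans ((ContinuousLinearMap.le_of_opNorm_le _ (hι z) _).trans ?_)
      rw [mul_comm]
      exact mul_le_mul_of_nonneg_right (by simpa using S.le_of_opNorm_le hS a) (norm_nonneg _)
    · refine (nrm_lTensor_le_of_isMultibounded hu n _).trans (mul_le_mul_of_nonneg_left ?_ hC)
      -- The isometry hypothesis passes from the norm of `X` to that of `Y`; `j` and `T` act on
      -- different factors and commute.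
      rw [← hj n]
      have : LinearMap.lTensor (Ellp p n) j (LinearMap.rTensor X T.toLinearMap t) =
          LinearMap.rTensor Y T.toLinearMap (LinearMap.lTensor E j t) := by
        rw [← LinearMap.comp_apply, ← LinearMap.comp_apply, LinearMap.lTensor_comp_rTensor,
          LinearMap.rTensor_comp_lTensor]
      rw [this]
      exact nrm_rTensor_le_extSeminorm β hT _
  -- A linear left inverse of `j`, with no continuity required, makes the functional well defined on
  -- the image of `E ⊗ X` in `E ⊗ Y`.
  obtain ⟨l, hl⟩ := j.exists_leftInverse_of_injective (LinearMap.ker_eq_bot.2 hj.injective)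
  have hl' : ∀ t : E ⊗[ℝ] X, LinearMap.lTensor E l (LinearMap.lTensor E j t) = t := fun t => by
    rw [← LinearMap.comp_apply, ← LinearMap.lTensor_comp, hl, LinearMap.lTensor_id]; rfl
  obtain ⟨ψ, hψ, hψN⟩ := exists_extension_of_le_sublinear
    ⟨LinearMap.range (LinearMap.lTensor E j), (traceForm (ι ∘ₗ u) ∘ₗ LinearMap.lTensor E l) ∘ₗ
      (LinearMap.range (LinearMap.lTensor E j)).subtype⟩
    (fun t => C * extSeminorm E β t)
    (fun c hc x => by rw [map_smul_eq_mul, Real.norm_of_nonneg hc.le]; ring)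
    (fun x y => by
      rw [← mul_add]; exact mul_le_mul_of_nonneg_left (map_add_le_add _ _ _) hC)
    (by
      rintro ⟨_, t, rfl⟩
      change traceForm (ι ∘ₗ u) (LinearMap.lTensor E l (LinearMap.lTensor E j t)) ≤ _
      rw [hl']
      exact hφ t)
  have hψj : ∀ t, ψ (LinearMap.lTensor E j t) = traceForm (ι ∘ₗ u) t := fun t => by
    refine (hψ ⟨LinearMap.lTensor E j t, t, rfl⟩).trans ?_
    change traceForm (ι ∘ₗ u) (LinearMap.lTensor E l (LinearMap.lTensor E j t)) = _
    rw [hl']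
  have hψb : ∀ (y : Y) (f : E), ‖ψ (f ⊗ₜ[ℝ] y)‖ ≤ (C * ‖y‖) * ‖f‖ := by
    have key : ∀ (y : Y) (f : E), ψ (f ⊗ₜ[ℝ] y) ≤ (C * ‖y‖) * ‖f‖ := fun y f =>
      (hψN _).trans <| by
        rw [mul_assoc, mul_comm ‖y‖]
        exact mul_le_mul_of_nonneg_left (extSeminorm_tmul_le β f y) hC
    intro y f
    rw [Real.norm_eq_abs, abs_le]
    have := key y (-f)
    rw [TensorProduct.neg_tmul, map_neg, norm_neg] at this
    exact ⟨by linarith, key y f⟩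
  -- The extended functional on `E ⊗ Y` read as a map into the dual of `E`.
  let v₀ : Y →ₗ[ℝ] StrongDual ℝ E :=
    { toFun := fun y => (ψ ∘ₗ (TensorProduct.mk ℝ E Y).flip y).mkContinuous (C * ‖y‖) (hψb y)
      map_add' := fun x y => ContinuousLinearMap.ext fun f => by
        change ψ (f ⊗ₜ[ℝ] (x + y)) = ψ (f ⊗ₜ[ℝ] x) + ψ (f ⊗ₜ[ℝ] y)
        rw [TensorProduct.tmul_add, map_add]
      map_smul' := fun c y => ContinuousLinearMap.ext fun f => by
        change ψ (f ⊗ₜ[ℝ] (c • y)) = c * ψ (f ⊗ₜ[ℝ] y)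
        rw [TensorProduct.tmul_smul, map_smul, smul_eq_mul] }
  have hv₀ : ∀ y f, v₀ y f = ψ (f ⊗ₜ[ℝ] y) := fun y f => rfl
  refine ⟨R ∘ₗ v₀, ?_, ?_⟩
  · ext x
    have : v₀ (j x) = ι (u x) := by
      ext f
      rw [hv₀]
      simpa using hψj (f ⊗ₜ[ℝ] x)
    rw [LinearMap.comp_apply, LinearMap.comp_apply, this, hRι]
  · have : pNorm β γ (R ∘ₗ v₀) ≤ ENNReal.ofReal C := by
      refine pNorm_le_of_forall_nrm_le hC fun n s => ?_
      rw [LinearMap.lTensor_comp, LinearMap.comp_apply]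
      refine (projNorm_lTensor_le R hR _).trans ?_
      -- Pairing with a contraction `S` amounts to evaluating `ψ` at `(S ⊗ I)s`. The seminorm there
      -- only sees the contractions `T ∘ S` between `ℓ^p`-spaces, for which `Y` is tensorial.
      refine Ellp.projNorm_le_of_operatorPairing_le _ fun S hS => ?_
      have h1 : operatorPairing S (LinearMap.lTensor (Ellp p n) v₀ s) =
          ψ (LinearMap.rTensor Y S.toLinearMap s) := by
        induction s with
        | zero => simp
        | tmul a y => simp [hv₀]
        | add s t hs ht => simp only [map_add, hs, ht]
      rw [h1]
      refine (hψN _).trans (mul_le_mul_of_nonneg_left (extSeminorm_le β _ fun m T hT => ?_) hC)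
      have h2 : LinearMap.rTensor Y T.toLinearMap (LinearMap.rTensor Y S.toLinearMap s) =
          LinearMap.rTensor Y (T ∘L S).toLinearMap s := by
        rw [← LinearMap.comp_apply, ← LinearMap.rTensor_comp]; rfl
      rw [h2]
      refine (β.tensorial n m _ s).trans (mul_le_of_le_one_left (apply_nonneg _ _) ?_)
      exact (T.opNorm_comp_le S).trans (mul_le_one₀ hT (norm_nonneg _) hS)
    rw [hCdef, ENNReal.ofReal_toReal hu.ne] at this
    simpa using this

end Extension

/-! ### Retracts and `ℓ^∞`-sums of injective spaces. -/

section Permanence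

variable {p : ℝ≥0∞} [Fact (1 ≤ p)]

universe v w

/-- `1`-injectivity of maximal spaces passes to contractive retracts. -/
theorem IsInjective.max_of_retract {Z W : Type*} [NormedAddCommGroup Z] [NormedSpace ℝ Z]
    [CompleteSpace Z] [NormedAddCommGroup W] [NormedSpace ℝ W] [CompleteSpace W]
    (h : IsInjective.{v, w} (maxPMultinorm p W) 1) (i : Z →ₗ[ℝ] W) (r : W →ₗ[ℝ] Z)
    (hi : ∀ z, ‖i z‖ ≤ ‖z‖) (hr : ∀ w, ‖r w‖ ≤ ‖w‖) (hri : ∀ z, r (i z) = z) :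
    IsInjective.{v, w} (maxPMultinorm p Z) 1 := by
  intro X _ _ _ Y _ _ _ α β j hj u hu
  have h1 := pNorm_comp_le α (β := maxPMultinorm p Z) (γ := maxPMultinorm p W) u (w := i)
    fun n t => projNorm_lTensor_le i hi t
  obtain ⟨v, hv, hvn⟩ := h X Y α β j hj (i ∘ₗ u) (h1.trans_lt hu)
  refine ⟨r ∘ₗ v, ?_, ?_⟩
  · ext x
    have := LinearMap.congr_fun hv x
    simp only [LinearMap.comp_apply] at this ⊢
    rw [this, hri]
  · refine (pNorm_comp_le β (β := maxPMultinorm p W) (γ := maxPMultinorm p Z) v (w := r)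
      fun n t => projNorm_lTensor_le r hr t).trans (hvn.trans ?_)
    gcongr

/-- An `ℓ^∞` sum of `1`-injective `p`-multinormed spaces is `1`-injective. -/
theorem IsInjective.linftySum {I : Type*} {Z : I → Type*} [∀ i, NormedAddCommGroup (Z i)]
    [∀ i, NormedSpace ℝ (Z i)] [∀ i, CompleteSpace (Z i)] {γ : ∀ i, PMultinorm p (Z i)}
    (h : ∀ i, IsInjective.{v, w} (γ i) 1) : IsInjective.{v, w} (linftySum γ) 1 := by
  intro X _ _ _ Y _ _ _ α β j hj u hu
  have hc : ∀ i, pNorm α (γ i) (linftyCoord Z i ∘ₗ u) ≤ pNorm α (_root_.linftySum γ) u := fun i =>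
    pNorm_comp_le α u fun n t => le_linftyNorm γ n t i
  choose v hv hvn using fun i => h i X Y α β j hj (linftyCoord Z i ∘ₗ u) ((hc i).trans_lt hu)
  set C := (pNorm α (_root_.linftySum γ) u).toReal
  have hC : 0 ≤ C := ENNReal.toReal_nonneg
  have hvle : ∀ i, pNorm β (γ i) (v i) ≤ pNorm α (_root_.linftySum γ) u := fun i =>
    (hvn i).trans (by simpa using hc i)
  have hvb : ∀ i, IsMultibounded β (γ i) (v i) := fun i => (hvle i).trans_lt hu
  have hvC : ∀ i, (pNorm β (γ i) (v i)).toReal ≤ C := fun i =>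
    ENNReal.toReal_mono hu.ne (hvle i)
  -- The coordinatewise extensions share the bound `C`, so together they take values in the
  -- `ℓ^∞`-sum.
  let V : Y →ₗ[ℝ] lp Z ∞ :=
    { toFun := fun y => ⟨fun i => v i y, memℓp_infty ⟨C * ‖y‖, by
        rintro _ ⟨i, rfl⟩
        exact (norm_le_of_isMultibounded (hvb i) y).trans
          (mul_le_mul_of_nonneg_right (hvC i) (norm_nonneg _))⟩⟩
      map_add' := fun x y => by ext i; exact map_add (v i) x y
      map_smul' := fun c y => by ext i; exact map_smul (v i) c y }
  have hV : ∀ i, linftyCoord Z i ∘ₗ V = v i := fun i => rfl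
  refine ⟨V, ?_, ?_⟩
  · ext x i
    exact LinearMap.congr_fun (hv i) x
  · have : pNorm β (_root_.linftySum γ) V ≤ ENNReal.ofReal C := by
      refine pNorm_le_of_forall_nrm_le hC fun n t => ?_
      refine linftyNorm_le γ n _ (mul_nonneg hC (apply_nonneg _ _)) fun i => ?_
      rw [← LinearMap.comp_apply, ← LinearMap.lTensor_comp, hV]
      exact (nrm_lTensor_le_of_isMultibounded (hvb i) n t).trans
        (mul_le_mul_of_nonneg_right (hvC i) (apply_nonneg _ _))
    rw [ENNReal.ofReal_toReal hu.ne] at this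
    simpa using this

end Permanence

end PMultinorm

/-! ### The Hölder pairing of `L^{p'}` with `L^p`. -/

section LpPairing

variable {Ω : Type*} [MeasurableSpace Ω] (μ : Measure Ω) (p p' : ℝ≥0∞) [Fact (1 ≤ p)]
  [Fact (1 ≤ p')] [hp : ENNReal.HolderConjugate p p']

/-- The canonical map `L^{p'} → (L^p)^*`. -/
def lpToDual : Lp ℝ p' μ →L[ℝ] StrongDual ℝ (Lp ℝ p μ) :=
  have : ENNReal.HolderConjugate p' p := hp.symm
  (ContinuousLinearMap.mul ℝ ℝ).lpPairing μ p' p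

variable {μ p p'}

theorem lpToDual_apply (g : Lp ℝ p' μ) (f : Lp ℝ p μ) : lpToDual μ p p' g f = ∫ x, g x * f x ∂μ :=
  have : ENNReal.HolderConjugate p' p := hp.symm
  ContinuousLinearMap.lpPairing_eq_integral _ _ _

theorem abs_lpToDual_apply_le (g : Lp ℝ p' μ) (f : Lp ℝ p μ) :
    |lpToDual μ p p' g f| ≤ ‖g‖ * ‖f‖ := by
  have : ENNReal.HolderConjugate p' p := hp.symm
  have h1 := ContinuousLinearMap.norm_holder_apply_apply_le (r := 1) (ContinuousLinearMap.mul ℝ ℝ) g f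
  have h2 : lpToDual μ p p' g f = L1.integral ((ContinuousLinearMap.mul ℝ ℝ).holder 1 g f) := by
    rw [lpToDual_apply, L1.integral_eq_integral]
    exact (integral_congr_ae ((ContinuousLinearMap.mul ℝ ℝ).coeFn_holder g f)).symm
  rw [h2]
  refine (L1.norm_integral_le _).trans (h1.trans ?_)
  gcongr
  exact mul_le_of_le_one_left (norm_nonneg _) (ContinuousLinearMap.opNorm_mul_le ℝ ℝ)

theorem norm_lpToDual_le (g : Lp ℝ p' μ) : ‖lpToDual μ p p' g‖ ≤ ‖g‖ :=
  ContinuousLinearMap.opNorm_le_bound _ (norm_nonneg _) fun f => abs_lpToDual_apply_le g f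

theorem lpToDual_indicatorConstLp (g : Lp ℝ p' μ) {A : Set Ω} (hA : MeasurableSet A)
    (hμA : μ A ≠ ∞) (c : ℝ) :
    lpToDual μ p p' g (indicatorConstLp p hA hμA c) = c * ∫ x in A, g x ∂μ := by
  rw [lpToDual_apply, ← integral_const_mul, ← integral_indicator hA]
  refine integral_congr_ae ?_
  filter_upwards [indicatorConstLp_coeFn (p := p) (hs := hA) (hμs := hμA) (c := c)] with x hx
  rw [hx]
  by_cases h : x ∈ A <;> simp [h, mul_comm]

end LpPairing

/-! ### The `p`-th powers of the norms as integrals and sums. -/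

section Norms

theorem toReal_pos_of_one_le (p : ℝ≥0∞) [Fact (1 ≤ p)] (hp : p ≠ ∞) : 0 < p.toReal :=
  ENNReal.toReal_pos (zero_lt_one.trans_le Fact.out).ne' hp

theorem enorm_le_enorm_iff_rpow {E F : Type*} [NormedAddCommGroup E] [NormedAddCommGroup F]
    {x : E} {y : F} {r : ℝ} (hr : 0 < r) : ‖x‖ₑ ^ r ≤ ‖y‖ₑ ^ r ↔ ‖x‖ ≤ ‖y‖ := by
  rw [ENNReal.rpow_le_rpow_iff hr, enorm_le_iff_norm_le]

theorem eLpNorm_rpow_toReal {Ω : Type*} [MeasurableSpace Ω] {μ : Measure Ω} {p : ℝ≥0∞}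
    (hp0 : p ≠ 0) (hp : p ≠ ∞) (f : Ω → ℝ) :
    eLpNorm f p μ ^ p.toReal = ∫⁻ x, ‖f x‖ₑ ^ p.toReal ∂μ := by
  rw [eLpNorm_eq_lintegral_rpow_enorm_toReal hp0 hp, ← ENNReal.rpow_mul,
    one_div, inv_mul_cancel₀ (ENNReal.toReal_pos hp0 hp).ne', ENNReal.rpow_one]

theorem Lp.enorm_rpow {Ω : Type*} [MeasurableSpace Ω] {μ : Measure Ω} {p : ℝ≥0∞} [Fact (1 ≤ p)]
    (hp : p ≠ ∞) (f : Lp ℝ p μ) : ‖f‖ₑ ^ p.toReal = ∫⁻ x, ‖f x‖ₑ ^ p.toReal ∂μ := by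
  rw [Lp.enorm_def, eLpNorm_rpow_toReal (zero_lt_one.trans_le Fact.out).ne' hp]

theorem Ellp.enorm_rpow {p : ℝ≥0∞} [Fact (1 ≤ p)] (hp : p ≠ ∞) {n : ℕ} (a : Ellp p n) :
    ‖a‖ₑ ^ p.toReal = ∑ k, ‖a k‖ₑ ^ p.toReal := by
  have hp0 := toReal_pos_of_one_le p hp
  have h : ∀ x : ℝ, ‖x‖ₑ ^ p.toReal = ENNReal.ofReal (‖x‖ ^ p.toReal) := fun x => by
    rw [← ofReal_norm, ENNReal.ofReal_rpow_of_nonneg (norm_nonneg _) hp0.le]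
  simp_rw [h]
  rw [← ENNReal.ofReal_sum_of_nonneg fun _ _ => by positivity, ← ofReal_norm,
    ENNReal.ofReal_rpow_of_nonneg (norm_nonneg _) hp0.le, PiLp.norm_eq_sum hp0,
    ← Real.rpow_mul (by positivity), one_div, inv_mul_cancel₀ hp0.ne', Real.rpow_one]

end Norms

/-! ### Averaging over finitely many disjoint sets, factored through `ℓ^p_n`. -/

section Averaging

variable {Ω : Type*} [MeasurableSpace Ω]

/-- A finite disjoint family of measurable sets of finite positive measure. -/
structure AtomFamily (μ : Measure Ω) (n : ℕ) where
  /-- The members of the family. -/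
  atom : Fin n → Set Ω
  meas : ∀ k, MeasurableSet (atom k)
  ne_top : ∀ k, μ (atom k) ≠ ∞
  ne_zero : ∀ k, μ (atom k) ≠ 0
  disj : Pairwise (Function.onFun Disjoint atom)

namespace AtomFamily

variable {μ : Measure Ω} {n : ℕ} (A : AtomFamily μ n) (p : ℝ≥0∞) [Fact (1 ≤ p)]

/-- The indicator function of an atom. -/
def ind (k : Fin n) : Lp ℝ p μ := indicatorConstLp p (A.meas k) (A.ne_top k) 1

theorem measureReal_pos (k : Fin n) : 0 < μ.real (A.atom k) :=
  ENNReal.toReal_pos (A.ne_zero k) (A.ne_top k)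

/-- The linear map `ℓ^p_n → L^p` sending the unit vectors to normalized indicator functions. -/
def embedₗ : Ellp p n →ₗ[ℝ] Lp ℝ p μ where
  -- For `p = ∞` the convention `∞.toReal = 0` makes the exponent zero, which is the correct weight;
  -- the same holds for the exponents of `averageₗ`.
  toFun a := ∑ k, (a k * μ.real (A.atom k) ^ (-p.toReal⁻¹)) • A.ind p k
  map_add' a b := by simp [add_mul, add_smul, Finset.sum_add_distrib]
  map_smul' c a := by simp [Finset.smul_sum, smul_smul, mul_assoc]

theorem integrableOn_atom (f : Lp ℝ p μ) (k : Fin n) : IntegrableOn f (A.atom k) μ := by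
  have : IsFiniteMeasure (μ.restrict (A.atom k)) := ⟨by
    rw [Measure.restrict_apply_univ]; exact (A.ne_top k).lt_top⟩
  exact ((Lp.memLp f).restrict _).integrable Fact.out

/-- The linear map `L^p → ℓ^p_n` given by normalized integrals over the atoms. -/
def averageₗ : Lp ℝ p μ →ₗ[ℝ] Ellp p n where
  toFun f := WithLp.toLp p fun k => μ.real (A.atom k) ^ (p.toReal⁻¹ - 1) * ∫ x in A.atom k, f x ∂μ
  map_add' f g := by
    ext k
    have h : ∫ x in A.atom k, (f + g) x ∂μ = ∫ x in A.atom k, f x ∂μ + ∫ x in A.atom k, g x ∂μ := by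
      rw [← integral_add (A.integrableOn_atom p f k) (A.integrableOn_atom p g k)]
      exact integral_congr_ae (ae_restrict_of_ae (Lp.coeFn_add f g))
    simp only [PiLp.add_apply]
    rw [h, mul_add]
  map_smul' c f := by
    ext k
    have h : ∫ x in A.atom k, (c • f) x ∂μ = c * ∫ x in A.atom k, f x ∂μ := by
      rw [← integral_const_mul]
      exact integral_congr_ae (ae_restrict_of_ae (Lp.coeFn_smul c f))
    simp only [PiLp.smul_apply, RingHom.id_apply, smul_eq_mul]
    rw [h]; ring

theorem embedₗ_coeFn (a : Ellp p n) : A.embedₗ p a =ᵐ[μ] fun x => ∑ k,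
    (A.atom k).indicator (fun _ => a k * μ.real (A.atom k) ^ (-p.toReal⁻¹)) x := by
  have h1 : ∀ k, ((a k * μ.real (A.atom k) ^ (-p.toReal⁻¹)) • A.ind p k : Lp ℝ p μ) =ᵐ[μ]
      (A.atom k).indicator (fun _ => a k * μ.real (A.atom k) ^ (-p.toReal⁻¹)) := fun k => by
    filter_upwards [Lp.coeFn_smul (a k * μ.real (A.atom k) ^ (-p.toReal⁻¹)) (A.ind p k),
      indicatorConstLp_coeFn (p := p) (hs := A.meas k) (hμs := A.ne_top k) (c := (1 : ℝ))]
      with x hx hx'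
    rw [hx, Pi.smul_apply, ind, hx']
    by_cases h : x ∈ A.atom k <;> simp [h]
  have h2 := Lp.coeFn_finsetSum Finset.univ
    fun k => ((a k * μ.real (A.atom k) ^ (-p.toReal⁻¹)) • A.ind p k : Lp ℝ p μ)
  filter_upwards [h2, ae_all_iff.2 h1] with x hx hx'
  change (∑ k, (a k * μ.real (A.atom k) ^ (-p.toReal⁻¹)) • A.ind p k : Lp ℝ p μ) x = _
  rw [hx, Finset.sum_apply]
  exact Finset.sum_congr rfl fun k _ => hx' k

theorem sum_indicator_eq_of_mem (c : Fin n → ℝ) {x : Ω} {k : Fin n} (hx : x ∈ A.atom k) :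
    ∑ j, (A.atom j).indicator (fun _ => c j) x = c k := by
  rw [Finset.sum_eq_single k]
  · simp [hx]
  · intro j _ hj
    exact Set.indicator_of_notMem (fun h => Set.disjoint_left.1 (A.disj hj) h hx) _
  · simp

theorem sum_indicator_eq_of_notMem (c : Fin n → ℝ) {x : Ω} (hx : ∀ k, x ∉ A.atom k) :
    ∑ j, (A.atom j).indicator (fun _ => c j) x = 0 :=
  Finset.sum_eq_zero fun j _ => Set.indicator_of_notMem (hx j) _

/-- The atoms are disjoint, so `p`-th powers add up and each weight cancels the measure of its atom;
for `p = ∞` only one summand is nonzero at each point. -/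
theorem norm_embedₗ_le (a : Ellp p n) : ‖A.embedₗ p a‖ ≤ ‖a‖ := by
  rcases eq_or_ne p ∞ with rfl | hp
  · rw [Lp.norm_def]
    refine ENNReal.toReal_le_of_le_ofReal (norm_nonneg _) ?_
    rw [eLpNorm_exponent_top]
    refine eLpNormEssSup_le_of_ae_bound ?_
    filter_upwards [A.embedₗ_coeFn ∞ a] with x hx
    rw [hx]
    by_cases h : ∃ k, x ∈ A.atom k
    · obtain ⟨k, hk⟩ := h
      rw [A.sum_indicator_eq_of_mem _ hk]
      simpa using PiLp.norm_apply_le a k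
    · push Not at h
      rw [A.sum_indicator_eq_of_notMem _ h, norm_zero]
      exact norm_nonneg _
  have hp0 := toReal_pos_of_one_le p hp
  rw [← enorm_le_enorm_iff_rpow hp0, Lp.enorm_rpow hp, Ellp.enorm_rpow hp]
  calc ∫⁻ x, ‖A.embedₗ p a x‖ₑ ^ p.toReal ∂μ
      = ∫⁻ x, ∑ k, (A.atom k).indicator
        (fun _ => ‖a k * μ.real (A.atom k) ^ (-p.toReal⁻¹)‖ₑ ^ p.toReal) x ∂μ := by
        refine lintegral_congr_ae ?_
        filter_upwards [A.embedₗ_coeFn p a] with x hx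
        rw [hx]
        by_cases h : ∃ k, x ∈ A.atom k
        · obtain ⟨k, hk⟩ := h
          rw [A.sum_indicator_eq_of_mem _ hk, Finset.sum_eq_single k]
          · simp [hk]
          · intro j _ hj
            exact Set.indicator_of_notMem (fun h => Set.disjoint_left.1 (A.disj hj) h hk) _
          · simp
        · push Not at h
          rw [A.sum_indicator_eq_of_notMem _ h]
          simp [h, hp0]
    _ = ∑ k, ‖a k * μ.real (A.atom k) ^ (-p.toReal⁻¹)‖ₑ ^ p.toReal * μ (A.atom k) := by
        rw [lintegral_finsetSum _ fun k _ => measurable_const.indicator (A.meas k)]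
        simp [lintegral_indicator, A.meas]
    _ = ∑ k, ‖a k‖ₑ ^ p.toReal := by
        refine Finset.sum_congr rfl fun k _ => ?_
        have hm := A.measureReal_pos k
        have h1 : ‖μ.real (A.atom k) ^ (-p.toReal⁻¹)‖ₑ ^ p.toReal = (μ (A.atom k))⁻¹ := by
          rw [Real.enorm_of_nonneg (by positivity), ENNReal.ofReal_rpow_of_pos (by positivity),
            ← Real.rpow_mul hm.le, neg_mul, inv_mul_cancel₀ hp0.ne', Real.rpow_neg_one,
            ENNReal.ofReal_inv_of_pos hm, Measure.real, ENNReal.ofReal_toReal (A.ne_top k)]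
        rw [enorm_mul, ENNReal.mul_rpow_of_nonneg _ _ hp0.le, h1, mul_assoc,
          ENNReal.inv_mul_cancel (A.ne_zero k) (A.ne_top k), mul_one]
  exact le_rfl

/-- Hölder on one atom `A` costs `μ(A)^{1 - 1/p}`, which the weight cancels. -/
theorem abs_averageₗ_apply_le (f : Lp ℝ p μ) (k : Fin n) :
    ‖A.averageₗ p f k‖ₑ ≤ eLpNorm f p (μ.restrict (A.atom k)) := by
  have hm := A.measureReal_pos k
  have hp1 : 1 ≤ p := Fact.out
  have hexp : 0 ≤ 1 - p.toReal⁻¹ := by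
    rcases eq_or_ne p ∞ with rfl | hp
    · simp
    · have : 1 ≤ p.toReal := by
        rw [← ENNReal.toReal_one]; exact ENNReal.toReal_mono hp hp1
      linarith [inv_le_one_of_one_le₀ this]
  have h1 : ‖∫ x in A.atom k, f x ∂μ‖ₑ ≤
      eLpNorm f p (μ.restrict (A.atom k)) * μ (A.atom k) ^ (1 - p.toReal⁻¹) := by
    refine (enorm_integral_le_lintegral_enorm _).trans ?_
    rw [← eLpNorm_one_eq_lintegral_enorm]
    refine (eLpNorm_le_eLpNorm_mul_rpow_measure_univ hp1
      (Lp.aestronglyMeasurable f).restrict).trans (le_of_eq ?_)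
    simp [one_div]
  change ‖μ.real (A.atom k) ^ (p.toReal⁻¹ - 1) * ∫ x in A.atom k, f x ∂μ‖ₑ ≤ _
  have h2 : ‖μ.real (A.atom k) ^ (p.toReal⁻¹ - 1)‖ₑ * μ (A.atom k) ^ (1 - p.toReal⁻¹) = 1 := by
    rw [Real.enorm_of_nonneg (by positivity), ← ENNReal.ofReal_rpow_of_pos hm, Measure.real,
      ENNReal.ofReal_toReal (A.ne_top k), ← ENNReal.rpow_add _ _ (A.ne_zero k) (A.ne_top k)]
    simp
  rw [enorm_mul]
  refine (mul_le_mul_right h1 _).trans (le_of_eq ?_)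
  rw [mul_left_comm, h2, mul_one]

theorem norm_averageₗ_le (f : Lp ℝ p μ) : ‖A.averageₗ p f‖ ≤ ‖f‖ := by
  rcases eq_or_ne p ∞ with rfl | hp
  · rw [PiLp.norm_eq_ciSup]
    refine Real.iSup_le (fun k => ?_) (norm_nonneg _)
    rw [← enorm_le_iff_norm_le, Lp.enorm_def]
    exact (A.abs_averageₗ_apply_le ∞ f k).trans (eLpNorm_mono_measure _ Measure.restrict_le_self)
  have hp0 := toReal_pos_of_one_le p hp
  rw [← enorm_le_enorm_iff_rpow hp0, Lp.enorm_rpow hp, Ellp.enorm_rpow hp]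
  calc ∑ k, ‖A.averageₗ p f k‖ₑ ^ p.toReal
      ≤ ∑ k, ∫⁻ x in A.atom k, ‖f x‖ₑ ^ p.toReal ∂μ := by
        refine Finset.sum_le_sum fun k _ => ?_
        refine (ENNReal.rpow_le_rpow (A.abs_averageₗ_apply_le p f k) hp0.le).trans (le_of_eq ?_)
        rw [eLpNorm_rpow_toReal (zero_lt_one.trans_le Fact.out).ne' hp]
    _ = ∫⁻ x in ⋃ k, A.atom k, ‖f x‖ₑ ^ p.toReal ∂μ := by
        rw [lintegral_iUnion A.meas A.disj, tsum_fintype]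
    _ ≤ ∫⁻ x, ‖f x‖ₑ ^ p.toReal ∂μ := setLIntegral_le_lintegral _ _

end AtomFamily

end Averaging

/-! ### Approximation of the identity of `L^p` by averaging operators. -/

namespace AtomFamily

section

variable {Ω : Type*} [MeasurableSpace Ω] {μ : Measure Ω} {n : ℕ} (A : AtomFamily μ n)
  (p : ℝ≥0∞) [Fact (1 ≤ p)]

/-- The map `ℓ^p_n → L^p` sending the unit vectors to normalized indicator functions. -/
def embed : Ellp p n →L[ℝ] Lp ℝ p μ :=
  (A.embedₗ p).mkContinuous 1 fun a => by simpa using A.norm_embedₗ_le p a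

/-- The map `L^p → ℓ^p_n` given by normalized integrals over the atoms. -/
def average : Lp ℝ p μ →L[ℝ] Ellp p n :=
  (A.averageₗ p).mkContinuous 1 fun a => by simpa using A.norm_averageₗ_le p a

theorem norm_embed_le : ‖A.embed p‖ ≤ 1 := LinearMap.mkContinuous_norm_le _ zero_le_one _

theorem norm_average_le : ‖A.average p‖ ≤ 1 := LinearMap.mkContinuous_norm_le _ zero_le_one _

/-- The two exponents add up to `-1`, so the composition is the usual average over atoms, given by
one formula for all `p`. Its symmetry in the pairing of `L^p` and `L^{p'}` rests on this. -/
theorem embed_average (f : Lp ℝ p μ) : A.embed p (A.average p f) =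
    ∑ k, ((μ.real (A.atom k))⁻¹ * ∫ x in A.atom k, f x ∂μ) • A.ind p k := by
  change ∑ k, (μ.real (A.atom k) ^ (p.toReal⁻¹ - 1) * (∫ x in A.atom k, f x ∂μ) *
    μ.real (A.atom k) ^ (-p.toReal⁻¹)) • A.ind p k = _
  refine Finset.sum_congr rfl fun k _ => ?_
  rw [mul_right_comm, ← Real.rpow_add (A.measureReal_pos k), sub_add_eq_add_sub, add_neg_cancel,
    zero_sub, Real.rpow_neg_one]

theorem norm_embed_average_le (f : Lp ℝ p μ) : ‖A.embed p (A.average p f)‖ ≤ ‖f‖ :=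
  (A.norm_embedₗ_le p _).trans (A.norm_averageₗ_le p f)

theorem setIntegral_ind (j k : Fin n) :
    ∫ x in A.atom k, A.ind p j x ∂μ = if j = k then μ.real (A.atom k) else 0 := by
  rw [ind, integral_congr_ae (ae_restrict_of_ae (indicatorConstLp_coeFn (p := p) (hs := A.meas j)
    (hμs := A.ne_top j) (c := (1 : ℝ)))), setIntegral_indicator (A.meas j)]
  split_ifs with h
  · subst h; simp [Measure.real]
  · rw [Set.disjoint_iff_inter_eq_empty.1 (A.disj (Ne.symm h))]; simp

theorem average_ind_sum (c : Fin n → ℝ) :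
    A.embed p (A.average p (∑ j, c j • A.ind p j)) = ∑ j, c j • A.ind p j := by
  simp only [map_sum, map_smul]
  refine Finset.sum_congr rfl fun j _ => ?_
  congr 1
  rw [embed_average]
  simp only [setIntegral_ind]
  rw [Finset.sum_eq_single j]
  · simp [(A.measureReal_pos j).ne']
  · intro k _ hk
    simp [Ne.symm hk]
  · simp

/-- The averaging operator fixes step functions over the atoms and is a contraction, whence the
factor `2`. -/
theorem embed_average_sub_le (g : Lp ℝ p μ) (c : Fin n → ℝ) {ε : ℝ}
    (h : ‖g - ∑ j, c j • A.ind p j‖ ≤ ε) : ‖g - A.embed p (A.average p g)‖ ≤ 2 * ε := by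
  set s := ∑ j, c j • A.ind p j
  have h1 : g - A.embed p (A.average p g) = (g - s) - A.embed p (A.average p (g - s)) := by
    rw [map_sub, map_sub, A.average_ind_sum p c]
    abel
  rw [h1]
  refine (norm_sub_le _ _).trans ?_
  linarith [A.norm_embed_average_le p (g - s)]

end

section

variable {Ω : Type*} [MeasurableSpace Ω] {μ : Measure Ω}

/-- Approximate each `g i` by a simple function; the level sets of the joint map `σ` of these simple
functions are atoms over which all of them are step functions simultaneously. -/
theorem exists_approx {p : ℝ≥0∞} [Fact (1 ≤ p)] (hp : p ≠ ∞) {k : ℕ} (g : Fin k → Lp ℝ p μ)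
    {ε : ℝ} (hε : 0 < ε) : ∃ (n : ℕ) (A : AtomFamily μ n), ∀ i,
      ‖g i - A.embed p (A.average p (g i))‖ ≤ ε := by
  classical
  have hp1 : p ≠ 0 := (zero_lt_one.trans_le Fact.out).ne'
  choose s hs hsm using fun i => (Lp.memLp (g i)).exists_simpleFunc_eLpNorm_sub_lt hp
    (ε := ENNReal.ofReal (ε / 2)) (by simpa using hε)
  let σ : Ω → Fin k → ℝ := fun x i => s i x
  have hσ : Measurable σ := measurable_pi_iff.2 fun i => (s i).measurable
  have hfin : (Set.range σ).Finite :=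
    (Set.Finite.pi' fun i => (s i).finite_range).subset (by
      rintro _ ⟨x, rfl⟩ i; exact ⟨x, rfl⟩)
  -- The value `0` is dropped because its level set may have infinite measure. The others have
  -- finite measure because `p < ∞`, and the null ones do not matter in `L^p`.
  let V : Finset (Fin k → ℝ) := hfin.toFinset.filter fun c => c ≠ 0 ∧ μ (σ ⁻¹' {c}) ≠ 0
  let e : Fin V.card ≃ V := V.equivFin.symm
  have hV : ∀ c : V, (c : Fin k → ℝ) ≠ 0 ∧ μ (σ ⁻¹' {(c : Fin k → ℝ)}) ≠ 0 := fun c =>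
    (Finset.mem_filter.1 c.2).2
  let A : AtomFamily μ V.card :=
    { atom := fun j => σ ⁻¹' {(e j : Fin k → ℝ)}
      meas := fun j => hσ (measurableSet_singleton _)
      ne_top := fun j => by
        obtain ⟨i, hi⟩ := Function.ne_iff.1 (hV (e j)).1
        refine ne_top_of_le_ne_top
          (SimpleFunc.measure_preimage_lt_top_of_memLp hp1 hp (s i) (hsm i) _ hi).ne
          (measure_mono fun x hx => ?_)
        exact congr_fun hx i
      ne_zero := fun j => (hV (e j)).2
      disj := fun j l hjl => by
        refine Set.disjoint_left.2 fun x hx hx' => hjl (e.injective (Subtype.ext ?_))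
        exact (show σ x = _ from hx).symm.trans hx' }
  have hnull : ∀ᵐ x ∂μ, ∀ c ∈ hfin.toFinset, μ (σ ⁻¹' {c}) = 0 → σ x ≠ c := by
    rw [Finset.eventually_all]
    intro c _
    by_cases hc : μ (σ ⁻¹' {c}) = 0
    · filter_upwards [measure_eq_zero_iff_ae_notMem.1 hc] with x hx _ using hx
    · exact Filter.Eventually.of_forall fun x h => absurd h hc
  refine ⟨V.card, A, fun i => ?_⟩
  have key : ((hsm i).toLp (s i) : Lp ℝ p μ) = ∑ j, (e j : Fin k → ℝ) i • A.ind p j := by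
    refine Lp.ext ?_
    have h1 : ∀ j, ((e j : Fin k → ℝ) i • A.ind p j : Lp ℝ p μ) =ᵐ[μ]
        (A.atom j).indicator (fun _ => (e j : Fin k → ℝ) i) := fun j => by
      filter_upwards [Lp.coeFn_smul ((e j : Fin k → ℝ) i) (A.ind p j),
        indicatorConstLp_coeFn (p := p) (hs := A.meas j) (hμs := A.ne_top j) (c := (1 : ℝ))]
        with x hx hx'
      rw [hx, Pi.smul_apply, ind, hx']
      by_cases h : x ∈ A.atom j <;> simp [h]
    filter_upwards [(hsm i).coeFn_toLp, Lp.coeFn_finsetSum Finset.univ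
      fun j => ((e j : Fin k → ℝ) i • A.ind p j : Lp ℝ p μ), ae_all_iff.2 h1, hnull]
      with x hx1 hx2 hx3 hx4
    rw [hx1, hx2, Finset.sum_apply, Finset.sum_congr rfl fun j _ => hx3 j]
    by_cases hx : σ x ∈ V
    · have hmem : x ∈ A.atom (e.symm ⟨σ x, hx⟩) := by
        change σ x = _
        simp
      rw [A.sum_indicator_eq_of_mem _ hmem]
      simp [σ]
    · have h0 : σ x = 0 := by
        by_contra h
        refine hx (Finset.mem_filter.2 ⟨by simp, h, fun h' => ?_⟩)
        exact hx4 (σ x) (by simp) h' rfl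
      rw [A.sum_indicator_eq_of_notMem]
      · exact congr_fun h0 i
      · intro j hj
        exact (hV (e j)).1 ((show σ x = _ from hj).symm.trans h0)
  have := A.embed_average_sub_le p (g i) (fun j => (e j : Fin k → ℝ) i) (ε := ε / 2) (by
    rw [← key, Lp.norm_def]
    refine ENNReal.toReal_le_of_le_ofReal (by positivity) ?_
    refine (le_of_eq (eLpNorm_congr_ae ?_)).trans (hs i).le
    filter_upwards [Lp.coeFn_sub (g i) ((hsm i).toLp (s i)), (hsm i).coeFn_toLp] with x h1 h2
    rw [h1, Pi.sub_apply, h2, Pi.sub_apply])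
  linarith

variable {p p' : ℝ≥0∞} [Fact (1 ≤ p)] [Fact (1 ≤ p')] [hp : ENNReal.HolderConjugate p p']

/-- Averaging is self-adjoint: both sides equal the sum of `μ(A)⁻¹ ∫_A g ∫_A f` over the atoms. -/
theorem lpToDual_embed_average {n : ℕ} (A : AtomFamily μ n) (g : Lp ℝ p' μ) (f : Lp ℝ p μ) :
    lpToDual μ p p' g (A.embed p (A.average p f)) =
      lpToDual μ p p' (A.embed p' (A.average p' g)) f := by
  have h : ENNReal.HolderConjugate p' p := hp.symm
  have h1 : lpToDual μ p p' (A.embed p' (A.average p' g)) f =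
      lpToDual μ p' p f (A.embed p' (A.average p' g)) := by
    rw [lpToDual_apply, lpToDual_apply]
    exact integral_congr_ae (Filter.Eventually.of_forall fun x => mul_comm _ _)
  rw [h1, embed_average, embed_average]
  simp only [map_sum, map_smul, smul_eq_mul, ind, lpToDual_indicatorConstLp]
  exact Finset.sum_congr rfl fun k _ => by ring

/-- For `p < ∞` the averages approximate the `f i` in norm. For `p = ∞` this can fail, but then `p'
< ∞`: the averages approximate the `z i` in norm and self-adjointness moves the averaging onto them.
-/
theorem exists_lpToDual_approx {k : ℕ} (f : Fin k → Lp ℝ p μ) (z : Fin k → Lp ℝ p' μ) {ε : ℝ}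
    (hε : 0 < ε) : ∃ (n : ℕ) (T : Lp ℝ p μ →L[ℝ] Ellp p n) (S : Ellp p n →L[ℝ] Lp ℝ p μ),
      ‖T‖ ≤ 1 ∧ ‖S‖ ≤ 1 ∧
        ∀ i, lpToDual μ p p' (z i) (f i) ≤ lpToDual μ p p' (z i) (S (T (f i))) + ε := by
  suffices ∃ (n : ℕ) (A : AtomFamily μ n), ∀ i, lpToDual μ p p' (z i) (f i) -
      lpToDual μ p p' (z i) (A.embed p (A.average p (f i))) ≤ ε by
    obtain ⟨n, A, h⟩ := this
    exact ⟨n, A.average p, A.embed p, A.norm_average_le p, A.norm_embed_le p, fun i => by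
      linarith [h i]⟩
  by_cases h : p = ∞
  · have hp' : p' ≠ ∞ := by
      rintro rfl
      subst h
      have := ENNReal.HolderConjugate.inv_add_inv_eq_one (∞ : ℝ≥0∞) ∞
      simp at this
    -- A common bound for the norms of the `f i`, made positive by the added `1`.
    set C := ∑ i, ‖f i‖ + 1 with hC
    have hC0 : 0 < C := by positivity
    obtain ⟨n, A, hA⟩ := exists_approx hp' z (div_pos hε hC0)
    refine ⟨n, A, fun i => ?_⟩
    rw [lpToDual_embed_average, ← sub_apply, ← map_sub]
    refine (le_abs_self _).trans ((abs_lpToDual_apply_le _ _).trans ?_)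
    have h1 : ‖f i‖ ≤ C := by
      have := Finset.single_le_sum (f := fun i => ‖f i‖) (fun _ _ => norm_nonneg _)
        (Finset.mem_univ i)
      linarith
    calc _ ≤ ε / C * C := mul_le_mul (hA i) h1 (norm_nonneg _) (by positivity)
      _ = ε := div_mul_cancel₀ _ hC0.ne'
  · set C := ∑ i, ‖z i‖ + 1 with hC
    have hC0 : 0 < C := by positivity
    obtain ⟨n, A, hA⟩ := exists_approx h f (div_pos hε hC0)
    refine ⟨n, A, fun i => ?_⟩
    rw [← map_sub]
    refine (le_abs_self _).trans ((abs_lpToDual_apply_le _ _).trans ?_)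
    have h1 : ‖z i‖ ≤ C := by
      have := Finset.single_le_sum (f := fun i => ‖z i‖) (fun _ _ => norm_nonneg _)
        (Finset.mem_univ i)
      linarith
    calc _ ≤ C * (ε / C) := mul_le_mul h1 (hA i) (norm_nonneg _) (by positivity)
      _ = ε := mul_div_cancel₀ _ hC0.ne'

end

end AtomFamily

/-! ### Multiplication operators between `L^p`-spaces. -/

section MulOperator

variable {Ω : Type*} [MeasurableSpace Ω] {μ ν : Measure Ω} {p : ℝ≥0∞} [Fact (1 ≤ p)]

/-- A multiplication operator `L^p(ν) → L^p(μ)` that does not increase the norm. -/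
def lpMul (φ : Ω → ℝ) (hae : ∀ f g : Ω → ℝ, f =ᵐ[ν] g → φ * f =ᵐ[μ] φ * g)
    (hle : ∀ f : Ω → ℝ, AEStronglyMeasurable f ν →
      AEStronglyMeasurable (φ * f) μ ∧ eLpNorm (φ * f) p μ ≤ eLpNorm f p ν) :
    Lp ℝ p ν →L[ℝ] Lp ℝ p μ :=
  have hm : ∀ f : Lp ℝ p ν, MemLp (φ * ⇑f) p μ := fun f =>
    ⟨(hle f (Lp.aestronglyMeasurable f)).1,
      (hle f (Lp.aestronglyMeasurable f)).2.trans_lt (Lp.eLpNorm_lt_top f)⟩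
  LinearMap.mkContinuous
    { toFun := fun f => (hm f).toLp
      map_add' := fun f g => by
        rw [← MemLp.toLp_add]
        refine MemLp.toLp_congr _ _ ((hae _ _ (Lp.coeFn_add f g)).trans ?_)
        rw [mul_add]
      map_smul' := fun c f => by
        rw [RingHom.id_apply, ← MemLp.toLp_const_smul]
        refine MemLp.toLp_congr _ _ ((hae _ _ (Lp.coeFn_smul c f)).trans ?_)
        rw [mul_smul_comm] } 1 fun f => by
    rw [one_mul]
    change ‖(hm f).toLp‖ ≤ ‖f‖
    rw [Lp.norm_toLp, Lp.norm_def]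
    exact ENNReal.toReal_mono (Lp.eLpNorm_ne_top f) (hle f (Lp.aestronglyMeasurable f)).2

theorem lpMul_coeFn (φ : Ω → ℝ) (hae : ∀ f g : Ω → ℝ, f =ᵐ[ν] g → φ * f =ᵐ[μ] φ * g)
    (hle : ∀ f : Ω → ℝ, AEStronglyMeasurable f ν →
      AEStronglyMeasurable (φ * f) μ ∧ eLpNorm (φ * f) p μ ≤ eLpNorm f p ν) (f : Lp ℝ p ν) :
    lpMul φ hae hle f =ᵐ[μ] φ * ⇑f :=
  MemLp.coeFn_toLp (f := φ * ⇑f) ⟨(hle f (Lp.aestronglyMeasurable f)).1,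
      (hle f (Lp.aestronglyMeasurable f)).2.trans_lt (Lp.eLpNorm_lt_top f)⟩

theorem norm_lpMul_le (φ : Ω → ℝ) (hae : ∀ f g : Ω → ℝ, f =ᵐ[ν] g → φ * f =ᵐ[μ] φ * g)
    (hle : ∀ f : Ω → ℝ, AEStronglyMeasurable f ν →
      AEStronglyMeasurable (φ * f) μ ∧ eLpNorm (φ * f) p μ ≤ eLpNorm f p ν) (f : Lp ℝ p ν) :
    ‖lpMul φ hae hle f‖ ≤ ‖f‖ := by
  rw [Lp.norm_def, Lp.norm_def, eLpNorm_congr_ae (lpMul_coeFn φ hae hle f)]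
  exact ENNReal.toReal_mono (Lp.eLpNorm_ne_top f) (hle f (Lp.aestronglyMeasurable f)).2

variable (μ p) in
/-- Multiplication by the indicator function of a measurable set. -/
def lpIndicator {S : Set Ω} (hS : MeasurableSet S) : Lp ℝ p μ →L[ℝ] Lp ℝ p μ :=
  lpMul (S.indicator 1)
    (fun f g h => by filter_upwards [h] with x hx; simp [hx])
    (fun f hf => ⟨(aestronglyMeasurable_one.indicator hS).mul hf, eLpNorm_mono fun x => by
      by_cases h : x ∈ S <;> simp [h]⟩)

theorem lpIndicator_coeFn {S : Set Ω} (hS : MeasurableSet S) (f : Lp ℝ p μ) :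
    lpIndicator μ p hS f =ᵐ[μ] S.indicator f := by
  refine (lpMul_coeFn _ _ _ f).trans (Filter.Eventually.of_forall fun x => ?_)
  by_cases h : x ∈ S <;> simp [h]

theorem norm_lpIndicator_le {S : Set Ω} (hS : MeasurableSet S) (f : Lp ℝ p μ) :
    ‖lpIndicator μ p hS f‖ ≤ ‖f‖ := norm_lpMul_le _ _ _ f

theorem lpIndicator_indicatorConstLp {S A : Set Ω} (hS : MeasurableSet S) (hA : MeasurableSet A)
    (hμA : μ A ≠ ∞) (c : ℝ) : lpIndicator μ p hS (indicatorConstLp p hA hμA c) =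
      indicatorConstLp p (hS.inter hA) (measure_ne_top_of_subset Set.inter_subset_right hμA) c := by
  refine Lp.ext ?_
  filter_upwards [lpIndicator_coeFn (p := p) hS (indicatorConstLp p hA hμA c),
    indicatorConstLp_coeFn (p := p) (hs := hA) (hμs := hμA) (c := c),
    indicatorConstLp_coeFn (p := p) (hs := hS.inter hA)
      (hμs := measure_ne_top_of_subset Set.inter_subset_right hμA) (c := c)] with x h1 h2 h3
  rw [h1, h3, ← Set.indicator_indicator]
  by_cases h : x ∈ S <;> simp [h, h2]

/-- Two functionals on `L^p`, `p < ∞`, that agree on indicator functions are equal. -/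
theorem lp_dual_ext (hp : p ≠ ∞) {F G : StrongDual ℝ (Lp ℝ p μ)}
    (h : ∀ (A : Set Ω) (hA : MeasurableSet A) (hμA : μ A ≠ ∞),
      F (indicatorConstLp p hA hμA 1) = G (indicatorConstLp p hA hμA 1)) : F = G := by
  ext f
  refine Lp.induction hp (motive := fun f => F f = G f) ?_ ?_ ?_ f
  · intro c s hs hμs
    have : ((Lp.simpleFunc.indicatorConst p hs hμs.ne c : Lp.simpleFunc ℝ p μ) : Lp ℝ p μ) =
        c • indicatorConstLp p hs hμs.ne (1 : ℝ) := by
      rw [Lp.simpleFunc.coe_indicatorConst]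
      refine Lp.ext ?_
      filter_upwards [Lp.coeFn_smul c (indicatorConstLp p hs hμs.ne (1 : ℝ)),
        indicatorConstLp_coeFn (p := p) (hs := hs) (hμs := hμs.ne) (c := (1 : ℝ)),
        indicatorConstLp_coeFn (p := p) (hs := hs) (hμs := hμs.ne) (c := c)] with x h1 h2 h3
      rw [h1, Pi.smul_apply, h2, h3]
      by_cases h : x ∈ s <;> simp [h]
    rw [this, map_smul, map_smul, h]
  · intro f g _ _ _ h1 h2
    rw [map_add, map_add, h1, h2]
  · exact isClosed_eq F.continuous G.continuous

end MulOperator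

/-! ### The converse of Hölder's inequality. -/

section ConverseHolder

variable {Ω : Type*} [MeasurableSpace Ω] {μ : Measure Ω} {p p' : ℝ≥0∞} [Fact (1 ≤ p)]
  [Fact (1 ≤ p')] [hp : ENNReal.HolderConjugate p p']

theorem Lp.norm_rpow_eq_integral (hp : p ≠ ∞) (f : Lp ℝ p μ) :
    ‖f‖ ^ p.toReal = ∫ x, |f x| ^ p.toReal ∂μ := by
  have h0 := toReal_pos_of_one_le p hp
  rw [integral_eq_lintegral_of_nonneg_ae (Filter.Eventually.of_forall fun x => by positivity)
    ((Lp.aestronglyMeasurable f).aemeasurable.abs.pow_const _).aestronglyMeasurable]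
  have : ∀ x, ENNReal.ofReal (|f x| ^ p.toReal) = ‖f x‖ₑ ^ p.toReal := fun x => by
    rw [← ENNReal.ofReal_rpow_of_nonneg (abs_nonneg _) h0.le, ← Real.norm_eq_abs, ofReal_norm]
  simp_rw [this]
  rw [← Lp.enorm_rpow hp, ← ENNReal.toReal_rpow, toReal_enorm]

/-- Test `g` on `h = g |g|^{p'-2}`, for which `g h = |g|^{p'} = |h|^p`. The test function lies in
`L^p` automatically, so the measure may be arbitrary. -/
theorem norm_le_of_holder_ne_top (hp1 : p ≠ ∞) (hp1' : p' ≠ ∞) (g : Lp ℝ p' μ) :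
    ‖g‖ ≤ ‖lpToDual μ p p' g‖ := by
  have h0 := toReal_pos_of_one_le p hp1
  have h0' := toReal_pos_of_one_le p' hp1'
  have hpq : p.toReal⁻¹ + p'.toReal⁻¹ = 1 := by
    rw [← ENNReal.toReal_inv, ← ENNReal.toReal_inv, ← ENNReal.toReal_add (by simp; exact fun h => by simp [h] at h0)
      (by simp; exact fun h => by simp [h] at h0'), ENNReal.HolderConjugate.inv_add_inv_eq_one]
    simp
  have hq1 : p'.toReal - 1 = p'.toReal / p.toReal := by
    field_simp at hpq ⊢
    linarith
  have hq2 : 0 < p'.toReal - 1 := by rw [hq1]; positivity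
  rcases eq_or_ne g 0 with rfl | hg
  · simp
  have hN : 0 < ‖g‖ := norm_pos_iff.2 hg
  set h : Ω → ℝ := fun x => g x * |g x| ^ (p'.toReal - 2) with hh
  have hgh : ∀ x, g x * h x = |g x| ^ p'.toReal := fun x => by
    rcases eq_or_ne (g x) 0 with hx | hx
    · simp [hh, hx, h0'.ne']
    · have : g x * h x = |g x| ^ (2 : ℕ) * |g x| ^ (p'.toReal - 2) := by
        rw [hh, sq_abs]; ring
      rw [this, ← Real.rpow_natCast, ← Real.rpow_add (abs_pos.2 hx)]
      congr 1; push_cast; ring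
  have habs : ∀ x, |h x| ^ p.toReal = |g x| ^ p'.toReal := fun x => by
    rcases eq_or_ne (g x) 0 with hx | hx
    · simp [hh, hx, h0'.ne', h0.ne']
    · have : |h x| = |g x| ^ (p'.toReal - 1) := by
        have e : p'.toReal - 1 = 1 + (p'.toReal - 2) := by ring
        rw [e, Real.rpow_one_add' (abs_nonneg _) (by rw [← e]; exact hq2.ne'), hh, abs_mul,
          abs_of_nonneg (a := |g x| ^ (p'.toReal - 2)) (by positivity)]
      rw [this, ← Real.rpow_mul (abs_nonneg _), hq1, div_mul_cancel₀ _ h0.ne']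
  have hm : AEStronglyMeasurable h μ := (Lp.aestronglyMeasurable g).mul
    ((Lp.aestronglyMeasurable g).aemeasurable.abs.pow_const _).aestronglyMeasurable
  have he : ∀ x, ‖h x‖ₑ ^ p.toReal = ‖g x‖ₑ ^ p'.toReal := fun x => by
    rw [← ofReal_norm, ← ofReal_norm, ENNReal.ofReal_rpow_of_nonneg (norm_nonneg _) h0.le,
      ENNReal.ofReal_rpow_of_nonneg (norm_nonneg _) h0'.le, Real.norm_eq_abs, Real.norm_eq_abs, habs]
  have hmem : MemLp h p μ := by
    refine ⟨hm, ?_⟩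
    rw [← ENNReal.rpow_lt_top_iff_of_pos h0,
      eLpNorm_rpow_toReal (zero_lt_one.trans_le Fact.out).ne' hp1]
    simp_rw [he]
    rw [← Lp.enorm_rpow hp1', ENNReal.rpow_lt_top_iff_of_pos h0']
    exact enorm_lt_top
  have h1 : lpToDual μ p p' g hmem.toLp = ‖g‖ ^ p'.toReal := by
    rw [lpToDual_apply, Lp.norm_rpow_eq_integral hp1']
    refine integral_congr_ae ?_
    filter_upwards [hmem.coeFn_toLp] with x hx
    rw [hx, hgh]
  have h2 : ‖hmem.toLp‖ ^ p.toReal = ‖g‖ ^ p'.toReal := by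
    rw [Lp.norm_rpow_eq_integral hp1, Lp.norm_rpow_eq_integral hp1']
    refine integral_congr_ae ?_
    filter_upwards [hmem.coeFn_toLp] with x hx
    rw [hx, habs]
  have h3 : ‖hmem.toLp‖ = ‖g‖ ^ (p'.toReal - 1) := by
    rw [hq1, div_eq_mul_inv, Real.rpow_mul hN.le, ← h2, ← Real.rpow_mul (norm_nonneg _),
      mul_inv_cancel₀ h0.ne', Real.rpow_one]
  have h4 := (le_abs_self _).trans ((lpToDual μ p p' g).le_opNorm hmem.toLp)
  rw [h1, h3] at h4
  have h5 : ‖g‖ ^ p'.toReal = ‖g‖ * ‖g‖ ^ (p'.toReal - 1) := by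
    rw [Real.rpow_sub_one hN.ne']; field_simp
  rw [h5] at h4
  exact le_of_mul_le_mul_right h4 (by positivity)

/-- Testing on indicators bounds the integrals of `g` and `-g` over any set of finite measure by `K`
times that measure; `σ`-finiteness turns this into a bound almost everywhere. -/
theorem norm_le_of_holder_top [SigmaFinite μ] (g : Lp ℝ ∞ μ) :
    ‖g‖ ≤ ‖lpToDual μ 1 ∞ g‖ := by
  set K := ‖lpToDual μ 1 ∞ g‖
  rw [Lp.norm_def]
  refine ENNReal.toReal_le_of_le_ofReal (norm_nonneg _) ?_
  rw [eLpNorm_exponent_top]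
  have key : ∀ (σ : ℝ), |σ| = 1 → ∀ᵐ x ∂μ, σ * g x ≤ K := by
    intro σ hσ
    have hint : ∀ s, MeasurableSet s → μ s < ∞ → IntegrableOn (fun x => σ * g x) s μ := by
      intro s _ hμs
      have : IsFiniteMeasure (μ.restrict s) := ⟨by rwa [Measure.restrict_apply_univ]⟩
      exact (((Lp.memLp g).restrict s).integrable le_top).const_mul σ
    have h := ae_nonneg_of_forall_setIntegral_nonneg_of_sigmaFinite (μ := μ)
      (f := fun x => K - σ * g x)
      (fun s hs hμs => (integrableOn_const hμs.ne).sub (hint s hs hμs)) (fun s hs hμs => by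
        have hc : IntegrableOn (fun _ => K) s μ := integrableOn_const hμs.ne
        rw [integral_sub hc (hint s hs hμs), integral_const_mul,
          setIntegral_const, sub_nonneg, ← lpToDual_indicatorConstLp (p := 1) g hs hμs.ne]
        refine (le_abs_self _).trans (((lpToDual μ 1 ∞ g).le_opNorm _).trans (le_of_eq ?_))
        rw [norm_indicatorConstLp one_ne_zero ENNReal.one_ne_top, Real.norm_eq_abs, hσ]
        simp [K, mul_comm])
    filter_upwards [h] with x hx
    exact sub_nonneg.1 hx
  refine eLpNormEssSup_le_of_ae_bound ?_
  filter_upwards [key 1 (by simp), key (-1) (by simp)] with x h1 h2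
  rw [Real.norm_eq_abs, abs_le]
  constructor <;> linarith

theorem norm_le_norm_lpToDual (hp1 : p ≠ ∞) (hμ : p = 1 → SigmaFinite μ) (g : Lp ℝ p' μ) :
    ‖g‖ ≤ ‖lpToDual μ p p' g‖ := by
  by_cases hp1' : p' = ∞
  · subst hp1'
    have : p = 1 := by
      have := ENNReal.HolderConjugate.inv_add_inv_eq_one p ∞
      simpa using this
    subst this
    have := hμ rfl
    exact norm_le_of_holder_top g
  · exact norm_le_of_holder_ne_top hp1 hp1' g

end ConverseHolder

/-! ### The dual of `L^p` for `p < ∞`. -/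

section Riesz

variable {Ω : Type*} [MeasurableSpace Ω] {p p' : ℝ≥0∞} [Fact (1 ≤ p)]
  [Fact (1 ≤ p')] [hp : ENNReal.HolderConjugate p p']

/-- The signed measure `A ↦ F(1_A)` of a functional on `L^p(μ)`, `μ` finite and `p < ∞`. -/
def dualSignedMeasure {μ : Measure Ω} [IsFiniteMeasure μ] (hp : p ≠ ∞)
    (F : StrongDual ℝ (Lp ℝ p μ)) : SignedMeasure Ω where
  measureOf' A := by
    classical
    exact if h : MeasurableSet A then F (indicatorConstLp p h (measure_ne_top μ A) 1) else 0
  empty' := by simp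
  not_measurable' A hA := by simp [hA]
  m_iUnion' A hA hd := by
    classical
    simp only [hA, MeasurableSet.iUnion hA, dite_true]
    refine HasSum.mapL F ?_
    have hpart : ∀ s : Finset ℕ, ∑ i ∈ s, indicatorConstLp p (hA i) (measure_ne_top μ _) (1 : ℝ) =
        indicatorConstLp p (s.measurableSet_biUnion fun i _ => hA i) (measure_ne_top μ _) 1 := by
      intro s
      induction s using Finset.induction_on with
      | empty => simp
      | insert i s hi ih =>
        rw [Finset.sum_insert hi, ih, ← indicatorConstLp_disjoint_union]
        · simp
        · rw [Set.disjoint_iUnion₂_right]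
          exact fun j hj => hd (by rintro rfl; exact hi hj)
    -- The finite unions exhaust the whole union in measure, and since `p < ∞` their indicators
    -- converge in `L^p`.
    have : Filter.Tendsto (fun s : Finset ℕ => indicatorConstLp p
        (s.measurableSet_biUnion fun i _ => hA i) (measure_ne_top μ _) (1 : ℝ)) Filter.atTop
        (nhds (indicatorConstLp p (MeasurableSet.iUnion hA) (measure_ne_top μ _) 1)) := by
      refine tendsto_indicatorConstLp_set hp ?_
      have h1 : ∀ s : Finset ℕ, symmDiff (⋃ i ∈ s, A i) (⋃ i, A i) =
          (⋃ i, A i) \ ⋃ i ∈ s, A i := fun s =>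
        symmDiff_of_le (Set.iUnion₂_subset fun i _ => Set.subset_iUnion A i)
      simp_rw [h1]
      have h2 := tendsto_measure_iInter_atTop (μ := μ)
        (s := fun s : Finset ℕ => (⋃ i, A i) \ ⋃ i ∈ s, A i)
        (fun s => ((MeasurableSet.iUnion hA).diff
          (s.measurableSet_biUnion fun i _ => hA i)).nullMeasurableSet)
        (fun s t hst => Set.sdiff_subset_sdiff_right (Set.biUnion_subset_biUnion_left hst))
        ⟨∅, measure_ne_top _ _⟩
      have h3 : ⋂ s : Finset ℕ, (⋃ i, A i) \ ⋃ i ∈ s, A i = ∅ := by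
        refine Set.eq_empty_of_forall_notMem fun x hx => ?_
        rw [Set.mem_iInter] at hx
        obtain ⟨i, hi⟩ := Set.mem_iUnion.1 (hx ∅).1
        exact (hx {i}).2 (by simpa using hi)
      rwa [h3, measure_empty] at h2
    refine Filter.Tendsto.congr (fun s => (hpart s).symm) this

theorem dualSignedMeasure_apply {μ : Measure Ω} [IsFiniteMeasure μ] (hp : p ≠ ∞)
    (F : StrongDual ℝ (Lp ℝ p μ)) {A : Set Ω} (hA : MeasurableSet A) :
    dualSignedMeasure hp F A = F (indicatorConstLp p hA (measure_ne_top μ A) 1) :=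
  dif_pos hA

/-- The density is the Radon–Nikodym derivative `ρ` of the signed measure `A ↦ F(1_A)`. Its
truncation to `{|ρ| ≤ n}` represents `F` composed with an indicator multiplication, so by the
converse of Hölder its `L^{p'}`-norm is at most `‖F‖`; Fatou gives the same for `ρ`. -/
theorem exists_lpToDual_eq_of_isFiniteMeasure {μ : Measure Ω} [IsFiniteMeasure μ] (hp : p ≠ ∞)
    (F : StrongDual ℝ (Lp ℝ p μ)) : ∃ g : Lp ℝ p' μ, lpToDual μ p p' g = F := by
  set ν := dualSignedMeasure hp F
  have hac : ν ≪ᵥ μ.toENNRealVectorMeasure := by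
    refine VectorMeasure.AbsolutelyContinuous.mk fun A hA h0 => ?_
    rw [Measure.toENNRealVectorMeasure_apply_measurable hA] at h0
    rw [dualSignedMeasure_apply hp F hA]
    have : indicatorConstLp p hA (measure_ne_top μ A) (1 : ℝ) = 0 := by
      refine norm_le_zero_iff.1 (norm_indicatorConstLp_le.trans ?_)
      rw [Measure.real, h0]
      have := toReal_pos_of_one_le p hp
      simp [Real.zero_rpow, this.ne']
    rw [this, map_zero]
  set ρ := ν.rnDeriv μ
  have hρi : Integrable ρ μ := SignedMeasure.integrable_rnDeriv ν μ
  have hρm : Measurable ρ := SignedMeasure.measurable_rnDeriv ν μ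
  have hρ : ∀ A (hA : MeasurableSet A),
      ∫ x in A, ρ x ∂μ = F (indicatorConstLp p hA (measure_ne_top μ A) 1) := fun A hA => by
    rw [← dualSignedMeasure_apply hp F hA, ← withDensityᵥ_apply hρi hA,
      (SignedMeasure.absolutelyContinuous_iff_withDensityᵥ_rnDeriv_eq ν μ).1 hac]
  let T : ℕ → Set Ω := fun n => {x | |ρ x| ≤ n}
  have hT : ∀ n, MeasurableSet (T n) := fun n => measurableSet_le hρm.abs measurable_const
  have hmem : ∀ n, MemLp ((T n).indicator ρ) p' μ := fun n =>
    MemLp.of_bound (hρm.indicator (hT n)).aestronglyMeasurable n (Filter.Eventually.of_forall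
      fun x => by
        by_cases h : x ∈ T n
        · rw [Set.indicator_of_mem h]; exact h
        · simp [h])
  have hdual : ∀ n, lpToDual μ p p' (hmem n).toLp = F ∘L lpIndicator μ p (hT n) := fun n => by
    refine lp_dual_ext hp fun A hA hμA => ?_
    rw [lpToDual_indicatorConstLp, ContinuousLinearMap.comp_apply, lpIndicator_indicatorConstLp,
      ← hρ, one_mul, Set.inter_comm, ← setIntegral_indicator (hT n)]
    exact integral_congr_ae (ae_restrict_of_ae (hmem n).coeFn_toLp)
  have hbound : ∀ n, eLpNorm ((T n).indicator ρ) p' μ ≤ ENNReal.ofReal ‖F‖ := fun n => by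
    have h1 : ‖(hmem n).toLp‖ ≤ ‖F‖ := by
      refine (norm_le_norm_lpToDual hp (fun _ => inferInstance) _).trans ?_
      rw [hdual]
      refine ContinuousLinearMap.opNorm_le_bound _ (norm_nonneg _) fun f => ?_
      exact (F.le_opNorm _).trans
        (mul_le_mul_of_nonneg_left (norm_lpIndicator_le _ _) (norm_nonneg _))
    rw [Lp.norm_toLp] at h1
    exact (ENNReal.le_ofReal_iff_toReal_le (hmem n).2.ne (norm_nonneg _)).2 h1
  have hρmem : MemLp ρ p' μ := by
    refine ⟨hρm.aestronglyMeasurable, lt_of_le_of_lt ?_ (ENNReal.ofReal_lt_top (r := ‖F‖))⟩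
    refine (Lp.eLpNorm_lim_le_liminf_eLpNorm (fun n => (hmem n).1) ρ
      (Filter.Eventually.of_forall fun x => ?_)).trans ?_
    · refine tendsto_const_nhds.congr' ?_
      filter_upwards [Filter.eventually_ge_atTop ⌈|ρ x|⌉₊] with n hn
      exact (Set.indicator_of_mem (show x ∈ T n from Nat.ceil_le.1 hn) ρ).symm
    · exact Filter.liminf_le_of_le (by isBoundedDefault) fun b hb => by
        obtain ⟨n, hn⟩ := hb.exists
        exact hn.trans (hbound n)
  refine ⟨hρmem.toLp, lp_dual_ext hp fun A hA hμA => ?_⟩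
  rw [lpToDual_indicatorConstLp, one_mul, ← hρ A hA]
  exact integral_congr_ae (ae_restrict_of_ae hρmem.coeFn_toLp)


/-- A functional on `L^p`, `p < ∞`, that is carried by a `σ`-finite set is given by a function in
`L^{p'}`. -/
theorem exists_lpToDual_eq_of_sigmaFinite_carrier {μ : Measure Ω} (hp1 : p ≠ ∞)
    (F : StrongDual ℝ (Lp ℝ p μ)) {S : Set Ω} (hS : MeasurableSet S)
    [SigmaFinite (μ.restrict S)] (hF : ∀ f, F (lpIndicator μ p hS f) = F f) :
    ∃ g : Lp ℝ p' μ, lpToDual μ p p' g = F := by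
  have h0 := toReal_pos_of_one_le p hp1
  -- A strictly positive weight of finite integral on `S` turns the restricted measure into a finite
  -- one, `ν`, with the same null sets inside `S`.
  obtain ⟨w, hw0, hwm, hwi⟩ := exists_pos_lintegral_lt_of_sigmaFinite (μ.restrict S)
    (ε := 1) one_ne_zero
  set ν : Measure Ω := (μ.restrict S).withDensity fun x => w x with hν
  have : IsFiniteMeasure ν := isFiniteMeasure_withDensity (hwi.trans ENNReal.one_lt_top).ne
  have hwm' : Measurable fun x => (w x : ℝ≥0∞) := hwm.coe_nnreal_ennreal
  have hae : ∀ {P : Ω → Prop}, (∀ᵐ x ∂ν, P x) ↔ ∀ᵐ x ∂μ, x ∈ S → P x := fun {P} => by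
    rw [hν, ae_withDensity_iff hwm', ae_restrict_iff' hS]
    simp [(hw0 _).ne']
  -- Multiplication by `w^{1/r}` is isometric from `L^r(ν)` into `L^r(μ)`; for `r = ∞` the exponent
  -- is zero and `W ∞` is the indicator of `S`.
  let W : ℝ≥0∞ → Ω → ℝ := fun r => S.indicator fun x => (w x : ℝ) ^ r.toReal⁻¹
  have hWm : ∀ r, Measurable (W r) := fun r => (hwm.coe_nnreal_real.pow_const _).indicator hS
  have hWae : ∀ r (f g : Ω → ℝ), f =ᵐ[ν] g → W r * f =ᵐ[μ] W r * g := fun r f g h => by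
    filter_upwards [hae.1 h] with x hx
    by_cases hxS : x ∈ S
    · rw [Pi.mul_apply, Pi.mul_apply, hx hxS]
    · simp [W, hxS]
  have hWmeas : ∀ r (f : Ω → ℝ), AEStronglyMeasurable f ν → AEStronglyMeasurable (W r * f) μ := by
    rintro r f ⟨g, hg, hfg⟩
    exact ⟨W r * g, (hWm r).stronglyMeasurable.mul hg, hWae r _ _ hfg⟩
  have hWn : ∀ (r : ℝ≥0∞), 1 ≤ r → ∀ (f : Ω → ℝ), AEStronglyMeasurable f ν →
      eLpNorm (W r * f) r μ = eLpNorm f r ν := by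
    intro r hr f hf
    rcases eq_or_ne r ∞ with rfl | hr'
    · have h1 : W ∞ * f = S.indicator f := by
        ext x
        by_cases hxS : x ∈ S <;> simp [W, hxS]
      rw [h1, eLpNorm_indicator_eq_eLpNorm_restrict hS, eLpNorm_exponent_top,
        eLpNorm_exponent_top]
      refine le_antisymm (eLpNormEssSup_mono_measure _ ?_)
        (eLpNormEssSup_mono_measure _ (withDensity_absolutelyContinuous _ _))
      exact withDensity_absolutelyContinuous' hwm'.aemeasurable
        (Filter.Eventually.of_forall fun x => by simpa using (hw0 x).ne')
    · have hr0 : r ≠ 0 := (zero_lt_one.trans_le hr).ne'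
      have hr1 : 0 < r.toReal := ENNReal.toReal_pos hr0 hr'
      apply ENNReal.rpow_left_injective hr1.ne'
      change eLpNorm _ _ _ ^ _ = eLpNorm _ _ _ ^ _
      rw [eLpNorm_rpow_toReal hr0 hr', eLpNorm_rpow_toReal hr0 hr',
        hν, lintegral_withDensity_eq_lintegral_mul₀' hwm'.aemeasurable
          (hf.enorm.pow_const _), ← lintegral_indicator hS]
      refine lintegral_congr fun x => ?_
      by_cases hxS : x ∈ S
      · have : ‖(w x : ℝ) ^ r.toReal⁻¹‖ₑ ^ r.toReal = w x := by
          rw [Real.enorm_of_nonneg (by positivity), ENNReal.ofReal_rpow_of_nonneg (by positivity)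
            hr1.le, ← Real.rpow_mul (by positivity), inv_mul_cancel₀ hr1.ne', Real.rpow_one,
            ENNReal.ofReal_coe_nnreal]
        simp [W, hxS, ENNReal.mul_rpow_of_nonneg _ _ hr1.le, this]
      · simp [W, hxS, hr1]
  have hWle : ∀ (r : ℝ≥0∞), 1 ≤ r → ∀ f : Ω → ℝ, AEStronglyMeasurable f ν →
      AEStronglyMeasurable (W r * f) μ ∧ eLpNorm (W r * f) r μ ≤ eLpNorm f r ν :=
    fun r hr f hf => ⟨hWmeas r f hf, (hWn r hr f hf).le⟩
  let M : Lp ℝ p ν →L[ℝ] Lp ℝ p μ := lpMul (W p) (hWae p) (hWle p Fact.out)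
  let M' : Lp ℝ p' ν →L[ℝ] Lp ℝ p' μ := lpMul (W p') (hWae p') (hWle p' Fact.out)
  obtain ⟨ρ, hρ⟩ := exists_lpToDual_eq_of_isFiniteMeasure (p' := p') hp1 (F ∘L M)
  -- If `ρ` represents `F ∘ M` over `ν`, then `w^{1/p'} ρ` represents `F`, because `w = w^{1/p}
  -- w^{1/p'}`.
  refine ⟨M' ρ, ?_⟩
  ext f
  -- `f = M k` on `S`
  obtain ⟨k, hk⟩ : ∃ k : Lp ℝ p ν, M k = lpIndicator μ p hS f := by
    let k : Ω → ℝ := fun x => (w x : ℝ) ^ (-p.toReal⁻¹) * f x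
    have hk : W p * k = S.indicator f := by
      ext x
      by_cases hxS : x ∈ S
      · have := (hw0 x)
        simp only [Pi.mul_apply, W, k, hxS, Set.indicator_of_mem]
        rw [← mul_assoc, ← Real.rpow_add (by exact_mod_cast hw0 x)]
        simp
      · simp [W, hxS]
    have hkm : AEStronglyMeasurable k ν := by
      refine (hwm.coe_nnreal_real.pow_const _).aestronglyMeasurable.mul ?_
      exact ((Lp.aestronglyMeasurable f).restrict (s := S)).mono_ac
        (withDensity_absolutelyContinuous _ _)
    have hkp : MemLp k p ν := ⟨hkm, by
      rw [← hWn p Fact.out k hkm, hk, eLpNorm_indicator_eq_eLpNorm_restrict hS]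
      exact (eLpNorm_mono_measure _ Measure.restrict_le_self).trans_lt (Lp.eLpNorm_lt_top f)⟩
    refine ⟨hkp.toLp, Lp.ext ?_⟩
    refine (lpMul_coeFn _ _ _ _).trans (((hWae p _ _ hkp.coeFn_toLp).trans ?_).trans
      (lpIndicator_coeFn hS f).symm)
    rw [hk]
  have h1 : F f = lpToDual ν p p' ρ k := by rw [hρ, ← hF, ← hk]; rfl
  have hint : ∫ x, ρ x * k x ∂ν = ∫ x in S, w x • (ρ x * k x) ∂μ :=
    integral_withDensity_eq_integral_smul hwm _
  rw [h1, lpToDual_apply, lpToDual_apply, hint, ← integral_indicator hS]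
  refine integral_congr_ae ?_
  filter_upwards [lpMul_coeFn (W p') (hWae p') (hWle p' Fact.out) ρ,
    lpMul_coeFn (W p) (hWae p) (hWle p Fact.out) k, lpIndicator_coeFn hS f] with x h1 h2 h3
  have h4 : M k x = S.indicator f x := by rw [hk]; exact h3
  change M' ρ x = _ at h1
  change M k x = _ at h2
  rw [h1]
  by_cases hxS : x ∈ S
  · rw [Set.indicator_of_mem hxS] at h4
    have hpq : p.toReal⁻¹ + p'.toReal⁻¹ = 1 := by
      rw [← ENNReal.toReal_inv, ← ENNReal.toReal_inv, ← ENNReal.toReal_add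
        (ENNReal.inv_ne_top.2 (zero_lt_one.trans_le Fact.out).ne')
        (ENNReal.inv_ne_top.2 (zero_lt_one.trans_le Fact.out).ne'),
        ENNReal.HolderConjugate.inv_add_inv_eq_one, ENNReal.toReal_one]
    have hw : (w x : ℝ) = (w x : ℝ) ^ p'.toReal⁻¹ * (w x : ℝ) ^ p.toReal⁻¹ := by
      rw [← Real.rpow_add (by exact_mod_cast hw0 x), add_comm, hpq, Real.rpow_one]
    rw [← h4, h2, Set.indicator_of_mem hxS]
    simp only [Pi.mul_apply, W, Set.indicator_of_mem hxS, NNReal.smul_def, smul_eq_mul]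
    conv_rhs => rw [hw]
    ring
  · simp [W, hxS]

/-- For `1 < p < ∞` every functional on `L^p` is carried by a `σ`-finite set. -/
theorem exists_sigmaFinite_carrier {μ : Measure Ω} (hp1 : p ≠ ∞) (hp2 : p ≠ 1)
    (F : StrongDual ℝ (Lp ℝ p μ)) : ∃ (S : Set Ω) (hS : MeasurableSet S),
      SigmaFinite (μ.restrict S) ∧ ∀ f, F (lpIndicator μ p hS f) = F f := by
  have h0 := toReal_pos_of_one_le p hp1
  have h1 : 1 < p.toReal := by
    rw [← ENNReal.toReal_one]
    exact (ENNReal.toReal_lt_toReal ENNReal.one_ne_top hp1).2 (lt_of_le_of_ne Fact.out (Ne.symm hp2))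
  have hnorming : ∀ n : ℕ, ∃ h : Lp ℝ p μ, ‖h‖ ≤ 1 ∧ ‖F‖ - 1 / (n + 1) ≤ F h := by
    intro n
    obtain ⟨h, hh, hh'⟩ := F.exists_lt_apply_of_lt_opNorm
      (sub_lt_self ‖F‖ (show (0 : ℝ) < 1 / (n + 1) by positivity))
    rcases le_abs.1 (show _ ≤ |F h| from hh'.le) with h1 | h1
    · exact ⟨h, hh.le, h1⟩
    · exact ⟨-h, by simpa using hh.le, by simpa using h1⟩
  choose h hh hF using hnorming
  -- The carrier is the union of the supports of an almost norming sequence. Each set `{|h n| ≥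
  -- 1/(m+1)}` has finite measure because `h n` lies in `L^p`.
  let B : ℕ × ℕ → Set Ω := fun i => {x | (1 : ℝ) / (i.2 + 1) ≤ ‖h i.1 x‖}
  have hBm : ∀ i, MeasurableSet (B i) := fun i =>
    measurableSet_le measurable_const (Lp.stronglyMeasurable _).norm.measurable
  have hBμ : ∀ i, μ (B i) < ∞ := fun i => by
    refine (measure_mono fun x hx => ?_).trans_lt ((Lp.memLp (h i.1)).meas_ge_lt_top'_enorm
      (zero_lt_one.trans_le Fact.out).ne' hp1 (ε := ENNReal.ofReal (1 / (i.2 + 1))) ?_ (by simp))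
    · change ENNReal.ofReal _ ≤ ‖h i.1 x‖ₑ
      rw [← ofReal_norm]
      exact ENNReal.ofReal_le_ofReal hx
    · exact (ENNReal.ofReal_pos.2 (by positivity)).ne'
  set S : Set Ω := ⋃ i, B i with hSdef
  have hS : MeasurableSet S := MeasurableSet.iUnion hBm
  have hσ : SigmaFinite (μ.restrict S) := by
    let e := (Denumerable.eqv (ℕ × ℕ)).symm
    -- The complement of `S` is null for the restricted measure; adding it to every set makes them
    -- cover the space.
    refine ⟨⟨⟨fun n => B (e n) ∪ Sᶜ, fun _ => trivial, fun n => ?_, ?_⟩⟩⟩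
    · rw [Measure.restrict_apply ((hBm _).union hS.compl)]
      refine (measure_mono ?_).trans_lt (hBμ (e n))
      rintro x ⟨hx | hx, hxS⟩
      · exact hx
      · exact absurd hxS hx
    · refine Set.eq_univ_of_forall fun x => ?_
      by_cases hx : x ∈ S
      · obtain ⟨i, hi⟩ := Set.mem_iUnion.1 hx
        exact Set.mem_iUnion.2 ⟨e.symm i, Or.inl (by simpa using hi)⟩
      · exact Set.mem_iUnion.2 ⟨0, Or.inr hx⟩
  have hhS : ∀ n x, x ∉ S → h n x = 0 := by
    intro n x hx
    by_contra hne
    obtain ⟨m, hm⟩ := exists_nat_one_div_lt (norm_pos_iff.2 hne)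
    exact hx (Set.mem_iUnion.2 ⟨(n, m), hm.le⟩)
  -- a functional that almost attains its norm at `h n` is small on functions disjoint from `h n`
  have key : ∀ k : Lp ℝ p μ, (∀ᵐ x ∂μ, x ∈ S → k x = 0) → F k ≤ 0 := by
    intro k hk
    -- The supports of `h n` and `k` are disjoint, so the `p`-th powers of the norms add.
    have hsum : ∀ (n : ℕ) (t : ℝ), 0 < t →
        ‖h n + t • k‖ ^ p.toReal ≤ 1 + t ^ p.toReal * ‖k‖ ^ p.toReal := by
      intro n t ht
      have hint : ∀ f : Lp ℝ p μ, Integrable (fun x => |f x| ^ p.toReal) μ := fun f => by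
        have := (Lp.memLp f).integrable_norm_rpow (zero_lt_one.trans_le Fact.out).ne' hp1
        simpa using this
      calc ‖h n + t • k‖ ^ p.toReal
          = ∫ x, (|h n x| ^ p.toReal + t ^ p.toReal * |k x| ^ p.toReal) ∂μ := by
            rw [Lp.norm_rpow_eq_integral hp1]
            refine integral_congr_ae ?_
            filter_upwards [hk, Lp.coeFn_add (h n) (t • k), Lp.coeFn_smul t k] with x hx h2 h3
            rw [h2, Pi.add_apply, h3, Pi.smul_apply, smul_eq_mul]
            by_cases hxS : x ∈ S
            · simp [hx hxS, h0.ne']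
            · simp [hhS n x hxS, h0.ne', abs_mul, abs_of_pos ht,
                Real.mul_rpow ht.le (abs_nonneg _)]
        _ = ‖h n‖ ^ p.toReal + t ^ p.toReal * ‖k‖ ^ p.toReal := by
            rw [integral_add (hint _) ((hint _).const_mul _), integral_const_mul,
              ← Lp.norm_rpow_eq_integral hp1, ← Lp.norm_rpow_eq_integral hp1]
        _ ≤ _ := by
            gcongr
            exact Real.rpow_le_one (norm_nonneg _) (hh n) h0.le
    -- Compare `F (h n + t • k) ≥ ‖F‖ - 1/(n+1) + t F k` with `‖F‖` times the norm, let `n → ∞` and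
    -- divide by `t`. The remaining power `t^{p-1}` tends to zero with `t` because `p > 1`.
    have hle : ∀ t : ℝ, 0 < t → F k ≤ ‖F‖ * ‖k‖ ^ p.toReal * t ^ (p.toReal - 1) := by
      intro t ht
      have h3 : ∀ n : ℕ, t * F k ≤ ‖F‖ * (t ^ p.toReal * ‖k‖ ^ p.toReal) + 1 / (n + 1) := by
        intro n
        -- No `p`-th root is taken: a number that is at least one is at most its `p`-th power.
        have h4 : ‖h n + t • k‖ ≤ 1 + t ^ p.toReal * ‖k‖ ^ p.toReal := by
          have h5 : 0 ≤ t ^ p.toReal * ‖k‖ ^ p.toReal := by positivity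
          by_contra! hlt
          have h6 := (hsum n t ht).trans_lt hlt
          have h7 : (1 : ℝ) ≤ ‖h n + t • k‖ := by linarith
          have := Real.rpow_le_rpow_of_exponent_le h7 h1.le
          rw [Real.rpow_one] at this
          linarith
        have h5 := (le_abs_self _).trans ((F.le_opNorm (h n + t • k)).trans
          (mul_le_mul_of_nonneg_left h4 (norm_nonneg F)))
        rw [map_add, map_smul, smul_eq_mul] at h5
        linarith [hF n]
      have h4 : t * F k ≤ ‖F‖ * (t ^ p.toReal * ‖k‖ ^ p.toReal) := by
        refine ge_of_tendsto (x := Filter.atTop) (b := t * F k)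
          (f := fun n : ℕ => ‖F‖ * (t ^ p.toReal * ‖k‖ ^ p.toReal) + 1 / ((n : ℝ) + 1)) ?_
          (Filter.Eventually.of_forall h3)
        simpa using (tendsto_const_nhds (x := ‖F‖ * (t ^ p.toReal * ‖k‖ ^ p.toReal))).add
          (tendsto_one_div_add_atTop_nhds_zero_nat (𝕜 := ℝ))
      rw [Real.rpow_sub_one ht.ne', mul_div_assoc', le_div_iff₀ ht]
      linarith
    have hlim : Filter.Tendsto (fun t : ℝ => ‖F‖ * ‖k‖ ^ p.toReal * t ^ (p.toReal - 1))
        (nhdsWithin 0 (Set.Ioi 0)) (nhds 0) := by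
      have : Filter.Tendsto (fun t : ℝ => ‖F‖ * ‖k‖ ^ p.toReal * t ^ (p.toReal - 1))
          (nhds 0) (nhds (‖F‖ * ‖k‖ ^ p.toReal * (0 : ℝ) ^ (p.toReal - 1))) :=
        ((Real.continuousAt_rpow_const 0 _ (Or.inr (by linarith))).tendsto).const_mul _
      rw [Real.zero_rpow (by linarith), mul_zero] at this
      exact this.mono_left nhdsWithin_le_nhds
    exact ge_of_tendsto hlim (Filter.mem_of_superset self_mem_nhdsWithin hle)
  refine ⟨S, hS, hσ, fun f => ?_⟩
  have hz : ∀ᵐ x ∂μ, x ∈ S → (lpIndicator μ p hS f - f) x = 0 := by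
    filter_upwards [Lp.coeFn_sub (lpIndicator μ p hS f) f, lpIndicator_coeFn hS f] with x h2 h3 hx
    rw [h2, Pi.sub_apply, h3, Set.indicator_of_mem hx, sub_self]
  have hz' : ∀ᵐ x ∂μ, x ∈ S → (-(lpIndicator μ p hS f - f)) x = 0 := by
    filter_upwards [Lp.coeFn_neg (lpIndicator μ p hS f - f), hz] with x h2 h3 hx
    rw [h2, Pi.neg_apply, h3 hx, neg_zero]
  have h2 := key _ hz
  have h3 := key _ hz'
  rw [map_neg, map_sub] at h3
  rw [map_sub] at h2
  linarith

theorem exists_lpToDual_eq {μ : Measure Ω} (hp1 : p ≠ ∞) (hμ : p = 1 → SigmaFinite μ)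
    (F : StrongDual ℝ (Lp ℝ p μ)) : ∃ g : Lp ℝ p' μ, lpToDual μ p p' g = F := by
  by_cases hp2 : p = 1
  · have := hμ hp2
    refine exists_lpToDual_eq_of_sigmaFinite_carrier hp1 F MeasurableSet.univ fun f => ?_
    congr 1
    refine Lp.ext ((lpIndicator_coeFn _ f).trans ?_)
    rw [Set.indicator_univ]
  · obtain ⟨S, hS, hσ, hF⟩ := exists_sigmaFinite_carrier hp1 hp2 F
    exact exists_lpToDual_eq_of_sigmaFinite_carrier hp1 F hS hF

end Riesz

/-! ### Yosida–Hewitt decomposition of bounded finitely additive set functions. -/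

section FinitelyAdditive

variable {Ω : Type*} [MeasurableSpace Ω]

/-- The positive part of a finitely additive set function. -/
def addPosPart (ν : Set Ω → ℝ) (A : Set Ω) : ℝ≥0∞ :=
  ⨆ B : {B : Set Ω // MeasurableSet B ∧ B ⊆ A}, ENNReal.ofReal (ν B)

instance (A : Set Ω) : Nonempty {B : Set Ω // MeasurableSet B ∧ B ⊆ A} :=
  ⟨⟨∅, MeasurableSet.empty, Set.empty_subset A⟩⟩

theorem le_addPosPart (ν : Set Ω → ℝ) {A B : Set Ω} (hB : MeasurableSet B) (hBA : B ⊆ A) :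
    ENNReal.ofReal (ν B) ≤ addPosPart ν A :=
  le_iSup (fun B : {B : Set Ω // MeasurableSet B ∧ B ⊆ A} => ENNReal.ofReal (ν B)) ⟨B, hB, hBA⟩

theorem addPosPart_mono (ν : Set Ω → ℝ) {A B : Set Ω} (hAB : A ⊆ B) :
    addPosPart ν A ≤ addPosPart ν B :=
  iSup_le fun C => le_addPosPart ν C.2.1 (C.2.2.trans hAB)

/-- Finite additivity on measurable sets. -/
def IsAddSetFunction (ν : Set Ω → ℝ) : Prop :=
  ∀ A B, MeasurableSet A → MeasurableSet B → Disjoint A B → ν (A ∪ B) = ν A + ν B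

variable {ν : Set Ω → ℝ}

theorem IsAddSetFunction.empty (hν : IsAddSetFunction ν) : ν ∅ = 0 := by
  have := hν ∅ ∅ MeasurableSet.empty MeasurableSet.empty (by simp)
  rw [Set.empty_union] at this
  linarith

theorem IsAddSetFunction.neg (hν : IsAddSetFunction ν) : IsAddSetFunction (-ν) :=
  fun A B hA hB h => by
    rw [Pi.neg_apply, Pi.neg_apply, Pi.neg_apply, hν A B hA hB h]; ring

theorem IsAddSetFunction.inter_add_diff (hν : IsAddSetFunction ν) {A B : Set Ω}
    (hA : MeasurableSet A) (hB : MeasurableSet B) : ν (A ∩ B) + ν (A \ B) = ν A := by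
  rw [← hν _ _ (hA.inter hB) (hA.diff hB) Set.disjoint_sdiff_inter.symm, Set.inter_union_sdiff]

theorem addPosPart_empty (hν : IsAddSetFunction ν) : addPosPart ν ∅ = 0 := by
  refine le_antisymm (iSup_le fun B => ?_) zero_le
  rw [Set.subset_empty_iff.1 B.2.2, hν.empty]
  simp

/-- A measurable subset of `A` splits along `B`, and conversely pieces on both sides can be united.
This is what makes measurable sets Carathéodory measurable in `countablyAdditivePart`. -/
theorem addPosPart_inter_add_diff (hν : IsAddSetFunction ν) (A : Set Ω) {B : Set Ω}
    (hB : MeasurableSet B) : addPosPart ν (A ∩ B) + addPosPart ν (A \ B) = addPosPart ν A := by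
  refine le_antisymm (ENNReal.iSup_add_iSup_le fun C D => ?_) (iSup_le fun C => ?_)
  · obtain ⟨C, hC, hCA⟩ := C
    obtain ⟨D, hD, hDA⟩ := D
    dsimp only
    rcases le_total (ν C) 0 with h | h
    · rw [ENNReal.ofReal_of_nonpos h, zero_add]
      exact le_addPosPart ν hD (hDA.trans Set.sdiff_subset)
    rcases le_total (ν D) 0 with h' | h'
    · rw [ENNReal.ofReal_of_nonpos h', add_zero]
      exact le_addPosPart ν hC (hCA.trans Set.inter_subset_left)
    rw [← ENNReal.ofReal_add h h', ← hν C D hC hD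
      (Set.disjoint_of_subset hCA hDA Set.disjoint_sdiff_inter.symm)]
    exact le_addPosPart ν (hC.union hD)
      (Set.union_subset (hCA.trans Set.inter_subset_left) (hDA.trans Set.sdiff_subset))
  · obtain ⟨C, hC, hCA⟩ := C
    dsimp only
    rw [← hν.inter_add_diff hC hB]
    refine ENNReal.ofReal_add_le.trans (add_le_add ?_ ?_)
    · exact le_addPosPart ν (hC.inter hB) (Set.inter_subset_inter_left _ hCA)
    · exact le_addPosPart ν (hC.diff hB) (Set.sdiff_subset_sdiff_left hCA)

theorem addPosPart_union_le (hν : IsAddSetFunction ν) (A : Set Ω) {B : Set Ω}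
    (hB : MeasurableSet B) : addPosPart ν (B ∪ A) ≤ addPosPart ν B + addPosPart ν A := by
  rw [← addPosPart_inter_add_diff hν (B ∪ A) hB]
  refine add_le_add (addPosPart_mono ν Set.inter_subset_right) (addPosPart_mono ν ?_)
  rw [Set.union_sdiff_left]
  exact Set.sdiff_subset

theorem addPosPart_biUnion_le (hν : IsAddSetFunction ν) {t : ℕ → Set Ω}
    (ht : ∀ i, MeasurableSet (t i)) (s : Finset ℕ) :
    addPosPart ν (⋃ i ∈ s, t i) ≤ ∑ i ∈ s, addPosPart ν (t i) := by
  induction s using Finset.induction_on with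
  | empty => simp [addPosPart_empty hν]
  | insert i s hi ih =>
    rw [Finset.set_biUnion_insert, Finset.sum_insert hi]
    exact (addPosPart_union_le hν _ (ht i)).trans (add_le_add le_rfl ih)

/-- The two parts are bounded jointly, not one by one, so that the total variation is at most `C`;
this keeps the retraction onto `L^1` contractive. A set on which the value has the wrong sign is
replaced by `∅`. -/
theorem addPosPart_add_addPosPart_neg_le {C : ℝ} (hν : IsAddSetFunction ν)
    (hC : ∀ A B, MeasurableSet A → MeasurableSet B → ν A - ν B ≤ C) :
    addPosPart ν Set.univ + addPosPart (-ν) Set.univ ≤ ENNReal.ofReal C := by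
  refine ENNReal.iSup_add_iSup_le fun A B => ?_
  obtain ⟨A, hA, -⟩ := A
  obtain ⟨B, hB, -⟩ := B
  dsimp only
  have h0 := hν.empty
  have hA' := hC A ∅ hA MeasurableSet.empty
  have hB' := hC ∅ B MeasurableSet.empty hB
  rw [h0] at hA' hB'
  rcases le_total (ν A) 0 with h | h
  · rw [ENNReal.ofReal_of_nonpos h, zero_add]
    exact ENNReal.ofReal_le_ofReal (by simpa using hB')
  rcases le_total ((-ν) B) 0 with h' | h'
  · rw [ENNReal.ofReal_of_nonpos h', add_zero]
    exact ENNReal.ofReal_le_ofReal (by simpa using hA')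
  rw [← ENNReal.ofReal_add h h']
  exact ENNReal.ofReal_le_ofReal (hC A B hA hB)

/-- The Jordan decomposition of a bounded finitely additive set function. -/
theorem eq_addPosPart_sub_addPosPart_neg (hν : IsAddSetFunction ν) {A : Set Ω} (hA : MeasurableSet A)
    (hfin : addPosPart ν A ≠ ∞) (hfin' : addPosPart (-ν) A ≠ ∞) :
    ν A = (addPosPart ν A).toReal - (addPosPart (-ν) A).toReal := by
  have h1 : ∀ {ν : Set Ω → ℝ}, IsAddSetFunction ν → addPosPart ν A ≠ ∞ →
      addPosPart (-ν) A ≠ ∞ → ν A + (addPosPart (-ν) A).toReal ≤ (addPosPart ν A).toReal := by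
    intro ν hν hfin hfin'
    have hle : ∀ B, MeasurableSet B → B ⊆ A → ν B ≤ (addPosPart ν A).toReal := fun B hB hBA =>
      (ENNReal.ofReal_le_iff_le_toReal hfin).1 (le_addPosPart ν hB hBA)
    rw [← le_sub_iff_add_le']
    refine ENNReal.toReal_le_of_le_ofReal (sub_nonneg.2 (hle A hA subset_rfl))
      (iSup_le fun B => ENNReal.ofReal_le_ofReal ?_)
    have h2 := hν.inter_add_diff hA B.2.1
    rw [Set.inter_eq_self_of_subset_right B.2.2] at h2
    have h3 := hle _ (hA.diff B.2.1) Set.sdiff_subset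
    rw [Pi.neg_apply]
    linarith
  have h2 := h1 hν hfin hfin'
  have h3 := h1 hν.neg hfin' (by rwa [neg_neg])
  rw [neg_neg, Pi.neg_apply] at h3
  linarith

/-- The largest countably additive measure below the positive part of a finitely additive set
function. -/
def countablyAdditivePart (ν : Set Ω → ℝ) (hν : IsAddSetFunction ν) : Measure Ω :=
  (OuterMeasure.ofFunction (extend fun (A : Set Ω) (_ : MeasurableSet A) => addPosPart ν A)
    (extend_empty MeasurableSet.empty (addPosPart_empty hν))).toMeasure fun B hB =>
      OuterMeasure.ofFunction_caratheodory fun A => by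
        by_cases hA : MeasurableSet A
        · rw [extend_eq _ hA, extend_eq _ (hA.inter hB), extend_eq _ (hA.diff hB),
            addPosPart_inter_add_diff hν A hB]
        · rw [extend_eq_top _ hA]
          exact le_top

theorem countablyAdditivePart_le (hν : IsAddSetFunction ν) {A : Set Ω} (hA : MeasurableSet A) :
    countablyAdditivePart ν hν A ≤ addPosPart ν A := by
  rw [countablyAdditivePart, toMeasure_apply _ _ hA]
  exact (OuterMeasure.ofFunction_le _).trans (by rw [extend_eq _ hA])

theorem exists_cover_of_countablyAdditivePart_lt (hν : IsAddSetFunction ν) {A : Set Ω}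
    (hA : MeasurableSet A) {r : ℝ≥0∞} (hr : countablyAdditivePart ν hν A < r) :
    ∃ t : ℕ → Set Ω, (∀ i, MeasurableSet (t i)) ∧ A ⊆ ⋃ i, t i ∧
      ∑' i, addPosPart ν (t i) < r := by
  rw [countablyAdditivePart, toMeasure_apply _ _ hA,
    OuterMeasure.ofFunction_eq_iInf_mem _ _ (P := MeasurableSet) (fun s hs => extend_eq_top _ hs)]
    at hr
  simp only [iInf_lt_iff] at hr
  obtain ⟨t, ht, htA, hlt⟩ := hr
  refine ⟨t, ht, htA, lt_of_le_of_lt (le_of_eq ?_) hlt⟩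
  refine tsum_congr fun i => ?_
  rw [extend_eq _ (ht i)]

/-- The difference between the positive part and its countably additive part is singular. -/
theorem exists_addPosPart_le_countablyAdditivePart_add (hν : IsAddSetFunction ν)
    (hfin : addPosPart ν Set.univ ≠ ∞) (μ : Measure Ω) {B : Set Ω} (hB : MeasurableSet B)
    (hμB : μ B ≠ ∞) {ε : ℝ≥0∞} (hε : ε ≠ 0) :
    ∃ A, MeasurableSet A ∧ μ A ≤ ε ∧ ∀ C, MeasurableSet C → C ⊆ B \ A →
      addPosPart ν C ≤ countablyAdditivePart ν hν C + ε := by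
  set m := countablyAdditivePart ν hν
  have hNfin : ∀ A, addPosPart ν A ≠ ∞ := fun A =>
    ne_top_of_le_ne_top hfin (addPosPart_mono ν (Set.subset_univ A))
  have hmfin : ∀ A, MeasurableSet A → m A ≠ ∞ := fun A hA =>
    ne_top_of_le_ne_top (hNfin A) (countablyAdditivePart_le hν hA)
  have hε2 : ε / 2 ≠ 0 := by simpa using hε
  obtain ⟨t, ht, htB, hlt⟩ := exists_cover_of_countablyAdditivePart_lt hν hB
    (ENNReal.lt_add_right (hmfin B hB) hε2)
  -- The part of `B` missed by the first `n` covering sets decreases to `∅`. It becomes small for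
  -- the measures `μ` and `m`, while its complement in `B` has a finite cover, to which finite
  -- subadditivity of `addPosPart ν` applies.
  let A : ℕ → Set Ω := fun n => B \ ⋃ i ∈ Finset.range n, t i
  have hAm : ∀ n, MeasurableSet (A n) := fun n =>
    hB.diff (Finset.measurableSet_biUnion _ fun i _ => ht i)
  have hAanti : Antitone A := fun n k hnk =>
    Set.sdiff_subset_sdiff_right (Set.biUnion_subset_biUnion_left (Finset.range_mono hnk))
  have hAinter : ⋂ n, A n = ∅ := by
    refine Set.eq_empty_of_forall_notMem fun x hx => ?_
    rw [Set.mem_iInter] at hx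
    obtain ⟨i, hi⟩ := Set.mem_iUnion.1 (htB (hx 0).1)
    exact (hx (i + 1)).2 (Set.mem_biUnion (Finset.mem_coe.2 (by simp)) hi)
  have hlim : ∀ κ : Measure Ω, κ B ≠ ∞ → ∀ᶠ n in Filter.atTop, κ (A n) ≤ ε / 2 := fun κ hκ => by
    have := tendsto_measure_iInter_atTop (μ := κ) (fun n => (hAm n).nullMeasurableSet) hAanti
      ⟨0, ne_top_of_le_ne_top hκ (measure_mono Set.sdiff_subset)⟩
    rw [hAinter, measure_empty] at this
    exact (this.eventually (gt_mem_nhds (pos_iff_ne_zero.2 hε2))).mono fun n hn => hn.le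
  obtain ⟨n, hn1, hn2⟩ := ((hlim μ hμB).and (hlim m (hmfin B hB))).exists
  refine ⟨A n, hAm n, hn1.trans ENNReal.half_le_self, fun C hC hCB => ?_⟩
  set D := B \ A n
  have hD : MeasurableSet D := hB.diff (hAm n)
  have hDt : D ⊆ ⋃ i ∈ Finset.range n, t i := fun x hx => by
    by_contra h
    exact hx.2 ⟨hx.1, h⟩
  have h1 : addPosPart ν D ≤ m B + ε / 2 :=
    (addPosPart_mono ν hDt).trans ((addPosPart_biUnion_le hν ht _).trans
      ((ENNReal.sum_le_tsum _).trans hlt.le))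
  have h2 : m B ≤ m D + ε / 2 := by
    have : m B ≤ m (A n) + m D := by
      rw [← Set.union_sdiff_cancel (show A n ⊆ B from Set.sdiff_subset)]
      exact (measure_union_le _ _)
    rw [add_comm] at this
    exact this.trans (add_le_add le_rfl hn2)
  have h3 : m D = m C + m (D \ C) := by
    rw [← measure_inter_add_sdiff D hC, Set.inter_eq_self_of_subset_right hCB]
  have h4 : addPosPart ν D = addPosPart ν C + addPosPart ν (D \ C) := by
    rw [← addPosPart_inter_add_diff hν D hC, Set.inter_eq_self_of_subset_right hCB]
  -- The excess of `addPosPart ν` over `m` is additive and nonnegative, so on `C` it is at most the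
  -- excess on `D`.
  have h5 := countablyAdditivePart_le hν (hD.diff hC)
  refine (ENNReal.add_le_add_iff_right (hNfin (D \ C))).1 ?_
  calc addPosPart ν C + addPosPart ν (D \ C) ≤ m B + ε / 2 := h4 ▸ h1
    _ ≤ m D + ε / 2 + ε / 2 := add_le_add h2 le_rfl
    _ = m C + m (D \ C) + ε := by rw [add_assoc, ENNReal.add_halves, h3]
    _ ≤ m C + addPosPart ν (D \ C) + ε := by gcongr
    _ = _ := by ring

/-- The Radon–Nikodym density of a finite measure with respect to an arbitrary measure. -/
theorem exists_integrable_setIntegral_eq (m μ : Measure Ω) [IsFiniteMeasure m] (hm : m ≪ μ) :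
    ∃ g : Ω → ℝ, Integrable g μ ∧ ∫ x, ‖g x‖ ∂μ ≤ m.real Set.univ ∧
      ∀ C, MeasurableSet C → μ C ≠ ∞ → ∫ x in C, g x ∂μ = m.real C := by
  -- On `S` the measure `μ` is `σ`-finite, and outside `S` a set of positive `m`-measure has
  -- infinite `μ`-measure. Hence `m` restricted to a set of finite `μ`-measure is carried by `S`.
  set S := μ.sigmaFiniteSetWRT m
  have hS : MeasurableSet S := measurableSet_sigmaFiniteSetWRT
  set h : Ω → ℝ := fun x => ((m.restrict S).rnDeriv (μ.restrict S) x).toReal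
  have hac : m.restrict S ≪ μ.restrict S := hm.restrict S
  have hint : Integrable h (μ.restrict S) := Measure.integrable_toReal_rnDeriv
  have hset : ∀ C, MeasurableSet C → ∫ x in C, S.indicator h x ∂μ = m.real (C ∩ S) := by
    intro C hC
    rw [setIntegral_indicator hS, ← Measure.restrict_restrict hC,
      Measure.setIntegral_toReal_rnDeriv hac, measureReal_restrict_apply hC]
  refine ⟨S.indicator h, (integrable_indicator_iff hS).2 hint, ?_, fun C hC hμC => ?_⟩
  · have h1 : ∀ x, ‖S.indicator h x‖ = S.indicator h x := fun x =>
      Real.norm_of_nonneg (Set.indicator_nonneg (fun _ _ => ENNReal.toReal_nonneg) x)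
    simp_rw [h1]
    rw [← setIntegral_univ, hset _ MeasurableSet.univ]
    exact measureReal_mono (Set.subset_univ _)
  · rw [hset C hC, Measure.real, Measure.real, ← measure_inter_add_sdiff C hS]
    suffices m (C \ S) = 0 by rw [this, add_zero]
    by_contra h0
    have := measure_eq_top_of_subset_compl_sigmaFiniteSetWRT (μ := μ) (ν := m)
      (s := C \ S) (fun x hx => hx.2) h0
    exact ne_top_of_le_ne_top hμC (measure_mono Set.sdiff_subset) this

/-- Two set functions differ by a singular one if, on every set of finite measure, they almost
agree off sets of small measure. -/
def EqModSingular (μ : Measure Ω) (ν κ : Set Ω → ℝ) : Prop :=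
  ∀ B, MeasurableSet B → μ B ≠ ∞ → ∀ ε : ℝ, 0 < ε → ∃ A, MeasurableSet A ∧
    μ A ≤ ENNReal.ofReal ε ∧ ∀ C, MeasurableSet C → C ⊆ B \ A → |ν C - κ C| ≤ ε

theorem EqModSingular.smul_add {μ : Measure Ω} {ν κ ν' κ' : Set Ω → ℝ}
    (h : EqModSingular μ ν κ) (h' : EqModSingular μ ν' κ') (c : ℝ) :
    EqModSingular μ (c • ν + ν') (c • κ + κ') := by
  intro B hB hμB ε hε
  -- Small enough that both `δ` and `|c| * δ` are at most `ε / 2`.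
  set δ := ε / 2 / (|c| + 1) with hδ
  have hδ0 : 0 < δ := by positivity
  have hc : |c| * δ ≤ ε / 2 := by
    rw [hδ, mul_div_assoc', div_le_iff₀ (by positivity)]
    nlinarith [abs_nonneg c]
  have hδε : δ ≤ ε / 2 := div_le_self (by positivity) (by linarith [abs_nonneg c])
  obtain ⟨A, hA, hμA, hAC⟩ := h B hB hμB δ hδ0
  obtain ⟨A', hA', hμA', hAC'⟩ := h' B hB hμB (ε / 2) (by positivity)
  refine ⟨A ∪ A', hA.union hA', ?_, fun C hC hCB => ?_⟩
  · calc μ (A ∪ A') ≤ μ A + μ A' := measure_union_le _ _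
      _ ≤ ENNReal.ofReal (ε / 2) + ENNReal.ofReal (ε / 2) :=
        add_le_add (hμA.trans (ENNReal.ofReal_le_ofReal hδε)) hμA'
      _ = ENNReal.ofReal ε := by rw [← ENNReal.ofReal_add (by positivity) (by positivity),
            add_halves]
  · have h1 := hAC C hC (hCB.trans (Set.sdiff_subset_sdiff_right Set.subset_union_left))
    have h2 := hAC' C hC (hCB.trans (Set.sdiff_subset_sdiff_right Set.subset_union_right))
    have h3 : (c • ν + ν') C - (c • κ + κ') C = c * (ν C - κ C) + (ν' C - κ' C) := by
      simp only [Pi.add_apply, Pi.smul_apply, smul_eq_mul]; ring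
    rw [h3]
    calc |c * (ν C - κ C) + (ν' C - κ' C)| ≤ |c| * |ν C - κ C| + |ν' C - κ' C| := by
          rw [← abs_mul]; exact abs_add_le _ _
      _ ≤ |c| * δ + ε / 2 := add_le_add (mul_le_mul_of_nonneg_left h1 (abs_nonneg c)) h2
      _ ≤ ε := by linarith

/-- An integrable density cannot be singular: its integral over the exceptional sets tends to zero
with their measure, and off them it is small by hypothesis. This yields uniqueness of the density.
-/
theorem setIntegral_eq_zero_of_eqModSingular {μ : Measure Ω} {g : Ω → ℝ} (hg : Integrable g μ)
    (h : EqModSingular μ 0 fun C => ∫ x in C, g x ∂μ) {B : Set Ω} (hB : MeasurableSet B)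
    (hμB : μ B ≠ ∞) : ∫ x in B, g x ∂μ = 0 := by
  choose A hA hμA hAC using fun n : ℕ => h B hB hμB (1 / (n + 1)) (by positivity)
  have hlim0 : Filter.Tendsto (fun n : ℕ => (1 : ℝ) / (n + 1)) Filter.atTop (nhds 0) :=
    tendsto_one_div_add_atTop_nhds_zero_nat
  have h1 : Filter.Tendsto (fun n => μ (B ∩ A n)) Filter.atTop (nhds 0) := by
    refine tendsto_of_tendsto_of_tendsto_of_le_of_le tendsto_const_nhds ?_ (fun _ => zero_le)
      fun n => (measure_mono Set.inter_subset_right).trans (hμA n)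
    simpa using ENNReal.tendsto_ofReal hlim0
  have h2 := hg.tendsto_setIntegral_nhds_zero h1
  have h3 : Filter.Tendsto (fun n => ∫ x in B \ A n, g x ∂μ) Filter.atTop (nhds 0) := by
    refine squeeze_zero_norm (fun n => ?_) hlim0
    simpa using hAC n (B \ A n) (hB.diff (hA n)) subset_rfl
  have h4 := h2.add h3
  simp_rw [integral_inter_add_sdiff (hA _) hg.integrableOn] at h4
  rw [add_zero] at h4
  exact tendsto_nhds_unique tendsto_const_nhds h4

/-- Every bounded finitely additive set function that vanishes on null sets is, up to a
singular one, given by an integrable density. -/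
theorem exists_eqModSingular {μ : Measure Ω} {ν : Set Ω → ℝ} {K : ℝ} (hν : IsAddSetFunction ν)
    (hK : ∀ A B, MeasurableSet A → MeasurableSet B → ν A - ν B ≤ K)
    (h0 : ∀ A, MeasurableSet A → μ A = 0 → ν A = 0) :
    ∃ g : Ω → ℝ, Integrable g μ ∧ ∫ x, ‖g x‖ ∂μ ≤ K ∧
      EqModSingular μ ν fun C => ∫ x in C, g x ∂μ := by
  have hsum := addPosPart_add_addPosPart_neg_le hν hK
  have hK0 : 0 ≤ K := by simpa using hK ∅ ∅ MeasurableSet.empty MeasurableSet.empty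
  have hfin : addPosPart ν Set.univ ≠ ∞ :=
    ne_top_of_le_ne_top ENNReal.ofReal_ne_top (le_self_add.trans hsum)
  have hfin' : addPosPart (-ν) Set.univ ≠ ∞ :=
    ne_top_of_le_ne_top ENNReal.ofReal_ne_top (le_add_self.trans hsum)
  -- The positive part has a density; the claim is applied to `ν` and to `-ν`, and the densities are
  -- subtracted along the Jordan decomposition.
  have main : ∀ {ν : Set Ω → ℝ} (hν : IsAddSetFunction ν),
      (∀ A, MeasurableSet A → μ A = 0 → ν A = 0) → addPosPart ν Set.univ ≠ ∞ →
      ∃ g : Ω → ℝ, Integrable g μ ∧ ∫ x, ‖g x‖ ∂μ ≤ (addPosPart ν Set.univ).toReal ∧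
        EqModSingular μ (fun C => (addPosPart ν C).toReal) fun C => ∫ x in C, g x ∂μ := by
    intro ν hν h0 hfin
    set m := countablyAdditivePart ν hν
    have : IsFiniteMeasure m :=
      ⟨(countablyAdditivePart_le hν MeasurableSet.univ).trans_lt hfin.lt_top⟩
    have hac : m ≪ μ := by
      refine Measure.AbsolutelyContinuous.mk fun A hA hμA => ?_
      refine le_antisymm ((countablyAdditivePart_le hν hA).trans (iSup_le fun B => ?_)) zero_le
      rw [h0 B B.2.1 (measure_mono_null B.2.2 hμA)]
      simp
    obtain ⟨g, hg, hgn, hgC⟩ := exists_integrable_setIntegral_eq m μ hac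
    refine ⟨g, hg, hgn.trans (ENNReal.toReal_mono hfin
      (countablyAdditivePart_le hν MeasurableSet.univ)), fun B hB hμB ε hε => ?_⟩
    obtain ⟨A, hA, hμA, hAC⟩ := exists_addPosPart_le_countablyAdditivePart_add hν hfin μ hB hμB
      (ENNReal.ofReal_pos.2 hε).ne'
    refine ⟨A, hA, hμA, fun C hC hCB => ?_⟩
    have hNC : addPosPart ν C ≠ ∞ :=
      ne_top_of_le_ne_top hfin (addPosPart_mono ν (Set.subset_univ C))
    have h1 := ENNReal.toReal_mono (by finiteness) (hAC C hC hCB)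
    rw [ENNReal.toReal_add (measure_ne_top _ _) ENNReal.ofReal_ne_top,
      ENNReal.toReal_ofReal hε.le] at h1
    have h2 := ENNReal.toReal_mono hNC (countablyAdditivePart_le hν hC)
    beta_reduce
    rw [hgC C hC (ne_top_of_le_ne_top hμB (measure_mono (hCB.trans Set.sdiff_subset))),
      Measure.real, abs_le]
    constructor <;> linarith
  obtain ⟨g, hg, hgn, hgs⟩ := main hν h0 hfin
  obtain ⟨g', hg', hgn', hgs'⟩ := main hν.neg (fun A hA h => by simp [h0 A hA h]) hfin'
  refine ⟨g - g', hg.sub hg', ?_, ?_⟩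
  · calc ∫ x, ‖(g - g') x‖ ∂μ ≤ ∫ x, (‖g x‖ + ‖g' x‖) ∂μ :=
          integral_mono (hg.sub hg').norm (hg.norm.add hg'.norm) fun x => norm_sub_le _ _
      _ = ∫ x, ‖g x‖ ∂μ + ∫ x, ‖g' x‖ ∂μ := integral_add hg.norm hg'.norm
      _ ≤ (addPosPart ν Set.univ + addPosPart (-ν) Set.univ).toReal := by
          rw [ENNReal.toReal_add hfin hfin']; exact add_le_add hgn hgn'
      _ ≤ K := ENNReal.toReal_le_of_le_ofReal hK0 hsum
  · have h1 := hgs'.smul_add hgs (-1)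
    intro B hB hμB ε hε
    obtain ⟨A, hA, hμA, hAC⟩ := h1 B hB hμB ε hε
    refine ⟨A, hA, hμA, fun C hC hCB => ?_⟩
    refine le_of_eq_of_le ?_ (hAC C hC hCB)
    rw [eq_addPosPart_sub_addPosPart_neg hν hC
      (ne_top_of_le_ne_top hfin (addPosPart_mono ν (Set.subset_univ C)))
      (ne_top_of_le_ne_top hfin' (addPosPart_mono (-ν) (Set.subset_univ C)))]
    have h2 : ∫ x in C, (g - g') x ∂μ = ∫ x in C, g x ∂μ - ∫ x in C, g' x ∂μ :=
      integral_sub hg.integrableOn hg'.integrableOn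
    beta_reduce
    rw [h2]
    simp only [Pi.add_apply, Pi.smul_apply, smul_eq_mul]
    congr 1
    ring

end FinitelyAdditive

/-! ### The contractive projection of `(L^∞)^*` onto `L^1`. -/

section DualLinfty

variable {Ω : Type*} [MeasurableSpace Ω] {μ : Measure Ω}

theorem memLp_top_indicator {A : Set Ω} (hA : MeasurableSet A) :
    MemLp (A.indicator fun _ => (1 : ℝ)) ∞ μ :=
  (memLp_top_const 1).indicator hA

open Classical in
/-- The finitely additive set function `A ↦ F(1_A)` of a functional on `L^∞(μ)`. -/
def dualSetFunction (F : StrongDual ℝ (Lp ℝ ∞ μ)) (A : Set Ω) : ℝ :=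
  if hA : MeasurableSet A then F (memLp_top_indicator hA).toLp else 0

theorem dualSetFunction_apply (F : StrongDual ℝ (Lp ℝ ∞ μ)) {A : Set Ω} (hA : MeasurableSet A) :
    dualSetFunction F A = F (memLp_top_indicator hA).toLp := dif_pos hA

theorem dualSetFunction_smul_add (F G : StrongDual ℝ (Lp ℝ ∞ μ)) (c : ℝ) :
    dualSetFunction (c • F + G) = c • dualSetFunction F + dualSetFunction G := by
  ext A
  by_cases hA : MeasurableSet A <;> simp [dualSetFunction, hA]

theorem isAddSetFunction_dualSetFunction (F : StrongDual ℝ (Lp ℝ ∞ μ)) :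
    IsAddSetFunction (dualSetFunction F) := by
  intro A B hA hB hd
  rw [dualSetFunction_apply F hA, dualSetFunction_apply F hB,
    dualSetFunction_apply F (hA.union hB), ← map_add, ← MemLp.toLp_add]
  congr 1
  refine MemLp.toLp_congr _ _ (Filter.Eventually.of_forall fun x => ?_)
  rw [Set.indicator_union_of_disjoint hd, Pi.add_apply]

/-- The difference of two indicators has sup norm at most one even when the sets overlap. This
provides the oscillation bound `K = ‖F‖` for `exists_eqModSingular`. -/
theorem dualSetFunction_sub_le (F : StrongDual ℝ (Lp ℝ ∞ μ)) {A B : Set Ω}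
    (hA : MeasurableSet A) (hB : MeasurableSet B) :
    dualSetFunction F A - dualSetFunction F B ≤ ‖F‖ := by
  rw [dualSetFunction_apply F hA, dualSetFunction_apply F hB, ← map_sub, ← MemLp.toLp_sub]
  refine (le_abs_self _).trans ((F.le_opNorm _).trans
    (mul_le_of_le_one_right (norm_nonneg _) ?_))
  rw [Lp.norm_toLp]
  refine ENNReal.toReal_le_of_le_ofReal zero_le_one ?_
  rw [eLpNorm_exponent_top]
  refine eLpNormEssSup_le_of_ae_bound (Filter.Eventually.of_forall fun x => ?_)
  by_cases h : x ∈ A <;> by_cases h' : x ∈ B <;> simp [h, h']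

theorem dualSetFunction_of_null (F : StrongDual ℝ (Lp ℝ ∞ μ)) {A : Set Ω}
    (hA : MeasurableSet A) (h : μ A = 0) : dualSetFunction F A = 0 := by
  rw [dualSetFunction_apply F hA]
  have : (memLp_top_indicator (μ := μ) hA).toLp = 0 := by
    rw [Lp.eq_zero_iff_ae_eq_zero]
    filter_upwards [(memLp_top_indicator (μ := μ) hA).coeFn_toLp,
      measure_eq_zero_iff_ae_notMem.1 h] with x h1 h2
    simp [h1, h2]
  rw [this, map_zero]

theorem dualSetFunction_lpToDual (g : Lp ℝ 1 μ) {A : Set Ω} (hA : MeasurableSet A) :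
    dualSetFunction (lpToDual μ ∞ 1 g) A = ∫ x in A, g x ∂μ := by
  rw [dualSetFunction_apply _ hA, lpToDual_apply, ← integral_indicator hA]
  refine integral_congr_ae ?_
  filter_upwards [(memLp_top_indicator (μ := μ) hA).coeFn_toLp] with x hx
  rw [hx]
  by_cases h : x ∈ A <;> simp [h]

theorem exists_lp_one_eqModSingular (F : StrongDual ℝ (Lp ℝ ∞ μ)) : ∃ g : Lp ℝ 1 μ,
    ‖g‖ ≤ ‖F‖ ∧ EqModSingular μ (dualSetFunction F) fun C => ∫ x in C, g x ∂μ := by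
  obtain ⟨g, hg, hgn, hgs⟩ := exists_eqModSingular (isAddSetFunction_dualSetFunction F)
    (fun A B hA hB => dualSetFunction_sub_le F hA hB) fun A hA => dualSetFunction_of_null F hA
  refine ⟨hg.toL1 g, ?_, ?_⟩
  · rw [L1.norm_of_fun_eq_integral_norm]
    exact hgn
  · have : ∀ C, ∫ x in C, (hg.toL1 g) x ∂μ = ∫ x in C, g x ∂μ := fun C =>
      integral_congr_ae (ae_restrict_of_ae hg.coeFn_toL1)
    simpa only [this] using hgs

theorem lp_one_eq_of_eqModSingular {F : StrongDual ℝ (Lp ℝ ∞ μ)} {g g' : Lp ℝ 1 μ}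
    (h : EqModSingular μ (dualSetFunction F) fun C => ∫ x in C, g x ∂μ)
    (h' : EqModSingular μ (dualSetFunction F) fun C => ∫ x in C, g' x ∂μ) : g = g' := by
  have hg := L1.integrable_coeFn g
  have hg' := L1.integrable_coeFn g'
  have h1 := h'.smul_add h (-1)
  have h2 : EqModSingular μ 0 fun C => ∫ x in C, (⇑g - ⇑g') x ∂μ := by
    have e1 : (-1 : ℝ) • dualSetFunction F + dualSetFunction F = 0 := by simp
    have e2 : ((-1 : ℝ) • (fun C => ∫ x in C, g' x ∂μ) + fun C => ∫ x in C, g x ∂μ) =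
        fun C => ∫ x in C, (⇑g - ⇑g') x ∂μ := by
      ext C
      have : ∫ x in C, (⇑g - ⇑g') x ∂μ = ∫ x in C, g x ∂μ - ∫ x in C, g' x ∂μ :=
        integral_sub hg.integrableOn hg'.integrableOn
      rw [this]
      simp only [Pi.add_apply, Pi.smul_apply, smul_eq_mul]
      ring
    rwa [e1, e2] at h1
  have h3 := (hg.sub hg').ae_eq_zero_of_forall_setIntegral_eq_zero fun s hs hμs =>
    setIntegral_eq_zero_of_eqModSingular (hg.sub hg') h2 hs hμs.ne
  refine Lp.ext ?_
  filter_upwards [h3] with x hx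
  simpa [sub_eq_zero] using hx

/-- `L^1` is a contractive retract of the dual of `L^∞`. -/
theorem exists_retract_lp_one (μ : Measure Ω) : ∃ R : StrongDual ℝ (Lp ℝ ∞ μ) →ₗ[ℝ] Lp ℝ 1 μ,
    (∀ F, ‖R F‖ ≤ ‖F‖) ∧ ∀ g, R (lpToDual μ ∞ 1 g) = g := by
  -- The density is merely chosen, but its uniqueness and the linearity of the relation
  -- `EqModSingular` force `R` to be linear.
  choose R hR hRs using exists_lp_one_eqModSingular (μ := μ)
  have hlin : ∀ (c : ℝ) F G, R (c • F + G) = c • R F + R G := fun c F G => by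
    refine lp_one_eq_of_eqModSingular (hRs _) ?_
    have h1 := (hRs F).smul_add (hRs G) c
    rw [← dualSetFunction_smul_add] at h1
    convert h1 using 1
    ext C
    have h2 : ∫ x in C, (c • R F + R G) x ∂μ = ∫ x in C, (c * R F x + R G x) ∂μ := by
      refine integral_congr_ae (ae_restrict_of_ae ?_)
      filter_upwards [Lp.coeFn_add (c • R F) (R G), Lp.coeFn_smul c (R F)] with x h3 h4
      rw [h3, Pi.add_apply, h4, Pi.smul_apply, smul_eq_mul]
    rw [h2, integral_add ((L1.integrable_coeFn (R F)).integrableOn.const_mul c)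
      (L1.integrable_coeFn (R G)).integrableOn, integral_const_mul]
    rfl
  have h0 : R 0 = 0 := by
    have := hlin 1 0 0
    simpa using this
  refine ⟨⟨⟨R, fun F G => by simpa using hlin 1 F G⟩, fun c F => by
    simpa [h0] using hlin c F 0⟩, hR, fun g => ?_⟩
  -- The set function of an `L^1` function has no singular part, so the empty exceptional set will
  -- do.
  refine lp_one_eq_of_eqModSingular (hRs (lpToDual μ ∞ 1 g)) fun B hB hμB ε hε =>
    ⟨∅, MeasurableSet.empty, by simp, fun C hC _ => ?_⟩
  rw [dualSetFunction_lpToDual g hC, sub_self, abs_zero]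
  exact hε.le

end DualLinfty

/-! ### Injectivity of `max_p(L^{p'})` and `max_p(ℓ^{p'}_n)`. -/

namespace PMultinorm

universe v w

variable {p p' : ℝ≥0∞} [Fact (1 ≤ p)] [Fact (1 ≤ p')]

section Lp

variable {Ω : Type*} [MeasurableSpace Ω] (μ : Measure Ω)

/-- `L^{p'}(μ)` is a contractive retract of the dual of `L^p(μ)`. -/
theorem exists_retract_lpToDual [hp : ENNReal.HolderConjugate p p']
    (hμ : p = 1 → SigmaFinite μ) : ∃ R : StrongDual ℝ (Lp ℝ p μ) →ₗ[ℝ] Lp ℝ p' μ,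
      (∀ F, ‖R F‖ ≤ ‖F‖) ∧ ∀ g, R (lpToDual μ p p' g) = g := by
  by_cases hp1 : p = ∞
  · subst hp1
    have h1 : p' = 1 := ENNReal.HolderConjugate.unique ∞ p' 1
    subst h1
    exact exists_retract_lp_one μ
  · have hinj : Function.Injective (lpToDual μ p p').toLinearMap := by
      refine (injective_iff_map_eq_zero _).2 fun g hg => ?_
      have h : ‖g‖ ≤ ‖lpToDual μ p p' g‖ := norm_le_norm_lpToDual hp1 hμ g
      have h0 : lpToDual μ p p' g = 0 := hg
      rw [h0, norm_zero] at h
      exact norm_le_zero_iff.1 h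
    -- For `p < ∞` the canonical map is onto the dual, and the retraction is its inverse,
    -- contractive by the converse of Hölder.
    let e := LinearEquiv.ofBijective (lpToDual μ p p').toLinearMap
      ⟨hinj, exists_lpToDual_eq hp1 hμ⟩
    refine ⟨e.symm.toLinearMap, fun F => ?_, fun g => e.symm_apply_apply g⟩
    have h : ‖e.symm F‖ ≤ ‖e (e.symm F)‖ := norm_le_norm_lpToDual hp1 hμ _
    rwa [e.apply_symm_apply] at h

theorem isInjective_max_lp [ENNReal.HolderConjugate p p'] (hμ : p = 1 → SigmaFinite μ) :
    IsInjective.{v, w} (maxPMultinorm p (Lp ℝ p' μ)) 1 := by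
  obtain ⟨R, hR, hRι⟩ := exists_retract_lpToDual (p := p) (p' := p') μ hμ
  exact isInjective_max_of_dual_retract (lpToDual μ p p').toLinearMap norm_lpToDual_le R hR hRι
    fun _ f z _ hε => AtomFamily.exists_lpToDual_approx f z hε

end Lp

section Ellp

variable {n : ℕ}

theorem ae_count_iff {q : Fin n → Prop} :
    (∀ᵐ x ∂(Measure.count : Measure (Fin n)), q x) ↔ ∀ x, q x := by
  simp [ae_iff, Measure.count_eq_zero_iff, Set.eq_empty_iff_forall_notMem]

/-- `ℓ^p_n` as a space of classes of functions for the counting measure. -/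
def ellpToLp (p : ℝ≥0∞) [Fact (1 ≤ p)] (n : ℕ) :
    Ellp p n →ₗ[ℝ] Lp ℝ p (Measure.count : Measure (Fin n)) where
  toFun a := (MemLp.of_discrete (f := fun k => a k)).toLp
  map_add' _ _ := rfl
  map_smul' _ _ := rfl

theorem ellpToLp_apply (a : Ellp p n) (k : Fin n) : ellpToLp p n a k = a k :=
  ae_count_iff.1 (MemLp.of_discrete (f := fun k => a k)).coeFn_toLp k

theorem norm_ellpToLp (a : Ellp p n) : ‖ellpToLp p n a‖ = ‖a‖ := by
  by_cases hp : p = ∞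
  · subst hp
    have h : ‖ellpToLp ∞ n a‖ₑ = ‖a‖ₑ := by
      rw [Lp.enorm_def, eLpNorm_exponent_top, eLpNormEssSup, essSup_count,
        enorm_eq_nnnorm, PiLp.nnnorm_eq_ciSup, ENNReal.coe_iSup (Finite.bddAbove_range _)]
      simp only [ellpToLp_apply, enorm_eq_nnnorm]
    exact enorm_eq_iff_norm_eq.1 h
  · have h := (Lp.enorm_rpow hp (ellpToLp p n a)).trans
      ((by simp [lintegral_count, tsum_fintype, ellpToLp_apply]) : _ = ∑ k, ‖a k‖ₑ ^ p.toReal)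
    rw [← Ellp.enorm_rpow hp] at h
    exact enorm_eq_iff_norm_eq.1 (ENNReal.rpow_left_injective (toReal_pos_of_one_le p hp).ne' h)

/-- The coordinates of a class of functions for the counting measure. -/
def lpToEllp (p : ℝ≥0∞) [Fact (1 ≤ p)] (n : ℕ) :
    Lp ℝ p (Measure.count : Measure (Fin n)) →ₗ[ℝ] Ellp p n where
  toFun f := WithLp.toLp p fun k => f k
  map_add' f g := by
    ext k
    exact ae_count_iff.1 (Lp.coeFn_add f g) k
  map_smul' c f := by
    ext k
    exact ae_count_iff.1 (Lp.coeFn_smul c f) k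

theorem ellpToLp_lpToEllp (f : Lp ℝ p (Measure.count : Measure (Fin n))) :
    ellpToLp p n (lpToEllp p n f) = f :=
  Lp.ext (ae_count_iff.2 fun k => ellpToLp_apply _ k)

/-- Counting measure on `Fin n` is finite, so the case of `L^{p'}` covers `p = 1` as well; the
identification is isometric, which is a special case of a contractive retract. -/
theorem isInjective_max_ellp [ENNReal.HolderConjugate p p'] :
    IsInjective.{v, w} (maxPMultinorm p (Ellp p' n)) 1 := by
  refine IsInjective.max_of_retract (isInjective_max_lp Measure.count fun _ => inferInstance)
    (ellpToLp p' n) (lpToEllp p' n) (fun z => (norm_ellpToLp z).le) (fun f => ?_) fun z => ?_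
  · rw [← norm_ellpToLp, ellpToLp_lpToEllp]
  · ext k
    exact ellpToLp_apply z k

end Ellp

end PMultinorm

end

universe u₁ u₂ u₃ u₄

theorem mainTheorem1 (p p' : ℝ≥0∞) [Fact (1 ≤ p)] [Fact (1 ≤ p')]
    (hp : ENNReal.HolderConjugate p p')
    {I : Type u₁} {Ω : I → Type u₂} [∀ i, MeasurableSpace (Ω i)] (μ : ∀ i, Measure (Ω i))
    (hμ : p = 1 → ∀ i, SigmaFinite (μ i)) :
    (∀ n : ℕ, PMultinorm.IsInjective.{u₃, u₄} (maxPMultinorm p (Ellp p' n)) 1) ∧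
    (∀ i, PMultinorm.IsInjective.{u₃, u₄} (maxPMultinorm p (Lp ℝ p' (μ i))) 1) ∧
    PMultinorm.IsInjective.{u₃, u₄} (linftySum fun i => maxPMultinorm p (Lp ℝ p' (μ i))) 1 :=
  have h i : PMultinorm.IsInjective.{u₃, u₄} (maxPMultinorm p (Lp ℝ p' (μ i))) 1 :=
    PMultinorm.isInjective_max_lp (μ i) fun h1 => hμ h1 i
  ⟨fun _ => PMultinorm.isInjective_max_ellp, h, PMultinorm.IsInjective.linftySum h⟩
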